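/- **Setting.** Let $\alpha\in\mathbb R$ and let $n_1>\dots>n_{r_1}\ge 0$, $m_1>\dots>m_{r_2}\ge0$, $m_1'>\dots>m'_{r_3}\ge0$, $n_1'>\dots>n'_{r_4}\ge0$ be (possibly empty) sequences of integers, encoding the Maya diagrams $M_1=(n'\,|\,n)$ and $M_2=(m'\,|\,m)$. Let $L_n^a$ be the Laguerre polynomials, $r=r_1+r_2+r_3+r_4$, and let $f_1,\dots,f_r$ be the functions on $(0,\infty)$ $$L^{\alpha}_{n_j}(x)\ (1\le j\le r_1),\quad e^xL^{\alpha}_{m_j}(-x)\ (1\le j\le r_2),\quad x^{-\alpha}L^{-\alpha}_{m_j'}(x)\ (1\le j\le r_3),\quad e^xx^{-\alpha}L^{-\alpha}_{n_j'}(-x)\ (1\le j\le r_4),$$ in this order. Let $M(a,b,x)={}_1F_1(a;b;x)$, and for $\lambda\in\mathbb C$ put $h(x,\lambda)=M(-\lambda,\alpha+1,x)$ and $\tilde h(x,\lambda)=x^{-\alpha}M(-\lambda-\alpha,1-\alpha,x)$. With $\mathrm{Wr}$ the Wronskian in $x$, define for $x>0$ $$\Omega(x)=e^{-(r_2+r_4)x}x^{(\alpha+r_1+r_2)(r_3+r_4)}\,\mathrm{Wr}[f_1,\dots,f_r],$$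 $$\Omega[h](x,\lambda)=e^{-(r_2+r_4)x}x^{(\alpha+r_1+r_2+1)(r_3+r_4)}\,\mathrm{Wr}[f_1,\dots,f_r,h],$$ $$\Omega[\tilde h](x,\lambda)=e^{-(r_2+r_4)x}x^{(\alpha+r_1+r_2)(r_3+r_4+1)}\,\mathrm{Wr}[f_1,\dots,f_r,\tilde h]$$ (the solutions of the first and second kind); values at $0$ are limits as $x\to0^+$. Let $\boldsymbol\alpha=\alpha-t_1-t_2+r(\mu)+r(\nu)$, where $t_1,t_2$ are the shifts putting $M_1,M_2$ into canonical form (no empty box to the left of the origin, first box to the right empty) and $r(\mu),r(\nu)$ are the numbers of filled boxes to the right of the origin after these shifts; thus $\boldsymbol\alpha=\alpha+r_1+r_2-r_3-r_4$. Let $\mathcal W(x)=x^{\boldsymbol\alpha}e^{-x}/\Omega(x)^2$ and let $$\mathcal L[y]=-xy''+\Big(x-\boldsymbol\alpha-1+2x\frac{\Omega'}{\Omega}\Big)y'+\Big(-x\frac{\Omega''}{\Omega}+(\boldsymbol\alpha-x)\frac{\Omega'}{\Omega}+r_1-r_4\Big)y$$ be the exceptional Laguerre expression, i.e. the Darboux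 transform of $-xy''+(x-\alpha-1)y'$ by $f_1,\dots,f_r$. Put $[f,g](x)=x\,\mathcal W(x)\,(f(x)g'(x)-f'(x)g(x))$, $\tilde y_1=-\Omega(0)/\boldsymbol\alpha$, $\tilde y_2=\Omega(0)x^{-\boldsymbol\alpha}$, and define the quasi-derivatives $f^{[0]}=[f,\tilde y_2]$, $f^{[1]}=[f,\tilde y_1]$, with values at $0$ again being limits as $x\to0^+$. **Statement.** Let $-1<\boldsymbol\alpha<1$, $\boldsymbol\alpha\ne0$. Then the limits $\Omega(0)$, $\Omega[h](0,\lambda)$ and $\Omega[\tilde h](0,\lambda)$ exist. Assume that they are non-zero, and set $$u_1(x,\lambda)=-\frac{\Omega(0)\,\Omega[h](x,\lambda)}{\boldsymbol\alpha\,\Omega[h](0,\lambda)},\qquad u_2(x,\lambda)=-\frac{\Omega(0)\,x^{-\boldsymbol\alpha}\,\Omega[\tilde h](x,\lambda)}{\Omega[\tilde h](0,\lambda)}.$$ Then: 1. For every $b\in(0,\infty]$ such that $\Omega$ has no zero in $(0,b)$ (in particular for $b=\infty$ if $\Omega$ has no zero in $(0,\infty)$), $(u_1,u_2)$ is a fundamental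 system of the equation $\mathcal L f=\lambda f$ on $(0,b)$: both functions are solutions, they are linearly independent on $(0,b)$, and every solution on $(0,b)$ is a linear combination of them. Moreover $u_1,u_2\in L^2((0,c),\mathcal W(x)\,dx)$ for all $0<c<b$. 2. The initial conditions $$\begin{pmatrix}u_1^{[0]}(0,\lambda)&u_2^{[0]}(0,\lambda)\\u_1^{[1]}(0,\lambda)&u_2^{[1]}(0,\lambda)\end{pmatrix}=\begin{pmatrix}1&0\\0&1\end{pmatrix}$$ hold. -/

import Mathlib

open Filter Topology MeasureTheory

noncomputable section

namespace ExceptionalLaguerre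

/-- The classical (generalized) Laguerre polynomial
`L_n^a(x) = ∑_{k ≤ n} (-1)^k (a+k+1)(a+k+2)⋯(a+n) / (k! (n-k)!) x^k`. -/
def laguerrePoly (a : ℝ) (n : ℕ) (x : ℝ) : ℝ :=
  ∑ k ∈ Finset.range (n + 1),
    (-1) ^ k * (ascPochhammer ℝ (n - k)).eval (a + k + 1)
      / ((k.factorial : ℝ) * ((n - k).factorial : ℝ)) * x ^ k

/-- Kummer's confluent hypergeometric function `M(a,b,z) = ₁F₁(a;b;z)`
(for `b` not in `{0,-1,-2,…}`), i.e. `Γ(b)` times the regularized one. -/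
def kummerM (a b z : ℂ) : ℂ :=
  Complex.Gamma b * Complex.regularizedHGFun {a} {b} z

/-- The solution `h^α(x,λ) = M(-λ, α+1, x)` of the classical Laguerre equation
`-x f'' + (x-α-1) f' = λ f`. -/
def hFirst (α : ℝ) (lam : ℂ) (x : ℝ) : ℂ :=
  kummerM (-lam) ((α : ℂ) + 1) (x : ℂ)

/-- The solution `x^{-α} M(-λ-α, 1-α, x)` of the classical Laguerre equation. -/
def hSecond (α : ℝ) (lam : ℂ) (x : ℝ) : ℂ :=
  ((x ^ (-α) : ℝ) : ℂ) * kummerM (-lam - (α : ℂ)) (1 - (α : ℂ)) (x : ℂ)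

/-- The Wronskian `Wr[F₁,…,F_N](x) = det (F_j^{(i)}(x))_{i,j}`, with `0 ≤ i < N`. -/
def wronskian {𝕜 : Type*} [RCLike 𝕜] {N : ℕ} (F : Fin N → ℝ → 𝕜) (x : ℝ) : 𝕜 :=
  (Matrix.of fun i j : Fin N => iteratedDeriv (i : ℕ) (F j) x).det

/-- The limit of `F(x)` as `x → 0⁺` (meaningful only if that limit exists). -/
def valueAtZero {𝕜 : Type*} [RCLike 𝕜] (F : ℝ → 𝕜) : 𝕜 :=
  limUnder (𝓝[>] (0 : ℝ)) F

/-- A pair of Maya diagrams `M₁ = (neg₁ | pos₁)`, `M₂ = (neg₂ | pos₂)`, encoded by strictly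
decreasing finite sequences: `posᵢ` lists the filled boxes `k ≥ 0`, and `negᵢ` lists the numbers
`-k-1` for the empty boxes `k < 0`. -/
structure MayaPair where
  r₁ : ℕ
  r₂ : ℕ
  r₃ : ℕ
  r₄ : ℕ
  pos₁ : Fin r₁ → ℕ
  pos₂ : Fin r₂ → ℕ
  neg₂ : Fin r₃ → ℕ
  neg₁ : Fin r₄ → ℕ
  pos₁_strictAnti : StrictAnti pos₁
  pos₂_strictAnti : StrictAnti pos₂
  neg₂_strictAnti : StrictAnti neg₂
  neg₁_strictAnti : StrictAnti neg₁

/-- The shift `t` putting the Maya diagram `(neg | pos)` into canonical form (no empty box to the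
left of the origin, first box to the right empty): `t = max neg + 1` if `neg` is nonempty, and
otherwise `-t` is the position of the first empty box. -/
def canonicalShift {k l : ℕ} (neg : Fin k → ℕ) (pos : Fin l → ℕ) : ℤ :=
  if h : 0 < k then (neg ⟨0, h⟩ : ℤ) + 1 else -((sInf (Set.range pos)ᶜ : ℕ) : ℤ)

/-- The number of filled boxes to the right of the origin after the Maya diagram `(neg | pos)` has
been shifted into canonical form, i.e. the length of the associated partition. -/
def canonicalLength {k l : ℕ} (neg : Fin k → ℕ) (pos : Fin l → ℕ) : ℤ :=
  if h : 0 < k then (l : ℤ) + ((neg ⟨0, h⟩ : ℤ) + 1) - k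
  else (l : ℤ) - ((sInf (Set.range pos)ᶜ : ℕ) : ℤ)

theorem canonicalLength_eq {k l : ℕ} (neg : Fin k → ℕ) (pos : Fin l → ℕ) :
    canonicalLength neg pos = (l : ℤ) - k + canonicalShift neg pos := by
  unfold canonicalLength canonicalShift
  split_ifs with h
  · ring
  · have : k = 0 := by omega
    subst this
    simp [sub_eq_add_neg]

namespace MayaPair

variable (M : MayaPair) (α : ℝ)

/-- The seed functions, in order: `L_n^α(x)` for `n` in `pos₁`, `e^x L_m^α(-x)` for `m` in `pos₂`,
`x^{-α} L_m^{-α}(x)` for `m` in `neg₂`, and `e^x x^{-α} L_n^{-α}(-x)` for `n` in `neg₁`. -/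
def seeds : Fin (M.r₁ + M.r₂ + M.r₃ + M.r₄) → ℝ → ℝ :=
  Fin.append (Fin.append (Fin.append
    (fun j x => laguerrePoly α (M.pos₁ j) x)
    (fun j x => Real.exp x * laguerrePoly α (M.pos₂ j) (-x)))
    (fun j x => x ^ (-α) * laguerrePoly (-α) (M.neg₂ j) x))
    (fun j x => Real.exp x * x ^ (-α) * laguerrePoly (-α) (M.neg₁ j) (-x))

/-- The Wronskian `Wr[f₁,…,f_r,y]` of the seed functions followed by `y`. -/
def seedWronskian (y : ℝ → ℂ) (x : ℝ) : ℂ :=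
  wronskian (Fin.snoc (α := fun _ => ℝ → ℂ) (fun j t => ((M.seeds α j t : ℝ) : ℂ)) y) x

/-- The generalized Laguerre polynomial
`Ω(x) = e^{-(r₂+r₄)x} x^{(α+r₁+r₂)(r₃+r₄)} Wr[f₁,…,f_r](x)` (for `x > 0`). -/
def omega (x : ℝ) : ℝ :=
  Real.exp (-((M.r₂ : ℝ) + M.r₄) * x) * x ^ ((α + M.r₁ + M.r₂) * ((M.r₃ : ℝ) + M.r₄))
    * wronskian (M.seeds α) x

/-- The solution of the first kind
`Ω[h](x) = e^{-(r₂+r₄)x} x^{(α+r₁+r₂+1)(r₃+r₄)} Wr[f₁,…,f_r,h](x)`. -/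
def omegaFirst (lam : ℂ) (x : ℝ) : ℂ :=
  ((Real.exp (-((M.r₂ : ℝ) + M.r₄) * x)
      * x ^ ((α + M.r₁ + M.r₂ + 1) * ((M.r₃ : ℝ) + M.r₄)) : ℝ) : ℂ)
    * M.seedWronskian α (hFirst α lam) x

/-- The solution of the second kind, with the prefactor
`e^{-(r₂+r₄)x} x^{(α+r₁+r₂)(r₃+r₄+1)}`. -/
def omegaSecond (lam : ℂ) (x : ℝ) : ℂ :=
  ((Real.exp (-((M.r₂ : ℝ) + M.r₄) * x)
      * x ^ ((α + M.r₁ + M.r₂) * ((M.r₃ : ℝ) + M.r₄ + 1)) : ℝ) : ℂ)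
    * M.seedWronskian α (hSecond α lam) x

/-- The parameter `α - t₁ - t₂ + r(μ) + r(ν)`, where `t₁`, `t₂` shift `M₁`, `M₂` into canonical
form and `r(μ)`, `r(ν)` are the lengths of the resulting partitions. -/
def boldAlpha : ℝ :=
  α - canonicalShift M.neg₁ M.pos₁ - canonicalShift M.neg₂ M.pos₂
    + canonicalLength M.neg₁ M.pos₁ + canonicalLength M.neg₂ M.pos₂

theorem boldAlpha_eq : M.boldAlpha α = α + M.r₁ + M.r₂ - M.r₃ - M.r₄ := by
  simp only [boldAlpha, canonicalLength_eq]
  push_cast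
  ring

/-- The weight `x^{α₀} e^{-x} / Ω(x)²` on `(0,∞)`, with `α₀` the parameter `boldAlpha`. -/
def weight (x : ℝ) : ℝ :=
  x ^ M.boldAlpha α * Real.exp (-x) / M.omega α x ^ 2

/-- The exceptional Laguerre expression, with `α₀` the parameter `boldAlpha`:
`ℒ y = -x y'' + (x - α₀ - 1 + 2xΩ'/Ω) y' + (-xΩ''/Ω + (α₀ - x)Ω'/Ω + r₁ - r₄) y`.
It is the rational Darboux transform of `ℓ y = -x y'' + (x-α-1) y'` by the seed functions, that is,
`ℒ A = A ℓ` for `A y = e^{-(r₂+r₄)x} x^{(α+r₁+r₂+1)(r₃+r₄)} Wr[f₁,…,f_r,y]`. Its first two terms are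
`-(1/W) (x W y')'` with `W` the weight above. -/
def expression (y : ℝ → ℂ) (x : ℝ) : ℂ :=
  -(x : ℂ) * deriv (deriv y) x
    + ((x - M.boldAlpha α - 1 + 2 * x * (deriv (M.omega α) x / M.omega α x) : ℝ) : ℂ)
        * deriv y x
    + ((-x * (deriv (deriv (M.omega α)) x / M.omega α x)
        + (M.boldAlpha α - x) * (deriv (M.omega α) x / M.omega α x)
        + M.r₁ - M.r₄ : ℝ) : ℂ) * y x

/-- The sesquilinear form `[f,g](x) = x W(x) (f(x) g'(x) - f'(x) g(x))`. -/
def bracket (f g : ℝ → ℂ) (x : ℝ) : ℂ :=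
  ((x * M.weight α x : ℝ) : ℂ) * (f x * deriv g x - deriv f x * g x)

/-- The constant function `-Ω(0)/α₀`. -/
def refFirst (_x : ℝ) : ℂ :=
  ((-(valueAtZero (M.omega α)) / M.boldAlpha α : ℝ) : ℂ)

/-- The function `Ω(0) x^{-α₀}`. -/
def refSecond (x : ℝ) : ℂ :=
  ((valueAtZero (M.omega α) * x ^ (-M.boldAlpha α) : ℝ) : ℂ)

/-- The quasi-derivative `f^{[0]} = [f, Ω(0) x^{-α₀}]`. -/
def quasiDeriv0 (f : ℝ → ℂ) (x : ℝ) : ℂ := M.bracket α f (M.refSecond α) x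

/-- The quasi-derivative `f^{[1]} = [f, -Ω(0)/α₀]`. -/
def quasiDeriv1 (f : ℝ → ℂ) (x : ℝ) : ℂ := M.bracket α f (M.refFirst α) x

/-- `u₁(x,λ) = -Ω(0) Ω[h](x,λ) / (α₀ Ω[h](0,λ))`. -/
def u₁ (lam : ℂ) (x : ℝ) : ℂ :=
  -(((valueAtZero (M.omega α) : ℝ) : ℂ) * M.omegaFirst α lam x)
    / (((M.boldAlpha α : ℝ) : ℂ) * valueAtZero (M.omegaFirst α lam))

/-- `u₂(x,λ) = -Ω(0) x^{-α₀} Ω[h₂](x,λ) / Ω[h₂](0,λ)`, with `h₂ = x^{-α} M(-λ-α,1-α,x)`. -/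
def u₂ (lam : ℂ) (x : ℝ) : ℂ :=
  -(((valueAtZero (M.omega α) : ℝ) : ℂ) * ((x ^ (-M.boldAlpha α) : ℝ) : ℂ)
      * M.omegaSecond α lam x)
    / valueAtZero (M.omegaSecond α lam)

/-- `y` is twice differentiable on the open set `J` and solves `ℒ y = λ y` there. -/
def IsSolutionOn (lam : ℂ) (J : Set ℝ) (y : ℝ → ℂ) : Prop :=
  ∀ x ∈ J, DifferentiableAt ℝ y x ∧ DifferentiableAt ℝ (deriv y) x ∧
    M.expression α y x = lam * y x

/-- `(v, w)` is a fundamental system of `ℒ f = λ f` on `J`: a basis of the space of solutions,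
regarded as functions on `J`. -/
structure IsFundamentalSystemOn (lam : ℂ) (J : Set ℝ) (v w : ℝ → ℂ) : Prop where
  left_solution : M.IsSolutionOn α lam J v
  right_solution : M.IsSolutionOn α lam J w
  independent : ∀ c d : ℂ, (∀ x ∈ J, c * v x + d * w x = 0) → c = 0 ∧ d = 0
  spanning : ∀ f : ℝ → ℂ, M.IsSolutionOn α lam J f →
    ∃ c d : ℂ, ∀ x ∈ J, f x = c * v x + d * w x

end MayaPair

end ExceptionalLaguerre

end

open ExceptionalLaguerre

/-! Write α₀ for `boldAlpha`, W for Wr[f₁,…,f_r], and h, h̃ for `hFirst`, `hSecond`. The functions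
Ω[h] and x^{-α₀}Ω[h̃] are values of one and the same Darboux transform A (`transform`: a prefactor
times Wr[f₁,…,f_r,y]) on the two Frobenius solutions at 0 of the classical Laguerre equation.

Crum's argument (`diffOp_eigen`, `expression_transform`) shows that A carries eigenfunctions to
eigenfunctions of ℒ. Modulo the Laguerre equation for y, the defect ℒAy - μAy is an operator of
order < r in y whose coefficients do not involve μ. Every seed is annihilated by A, hence by this
operator, and W(x) ≠ 0 forces its coefficients to vanish at x.

The behaviour at 0 comes from `exists_analyticAt_wronskian`: a Wronskian of p analytic functions and
s functions x^{-α}·(analytic) is x^{-(α+p)s} times a function analytic at 0, because in the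
expansion of the determinant in powers of x all terms of too low order have two proportional
columns. So Ω, Ω[h], Ω[h̃] extend analytically to 0, the limits exist, and u₁, u₂ are 1 and x^{-α₀}
times analytic functions, up to constants.

The rest compares exponents. The bracket of x^e G and x^d H is e^{-x}x^{α₀+e+d}Ω^{-2} times (d-e)GH
+ x(GH' - G'H) (`bracket_eventuallyEq`). Exponents 0 and -α₀ give a finite limit; equal exponents
kill the first term, and the remaining power 1+α₀ or 1-α₀ is positive since |α₀| < 1. The same bound
gives square integrability at 0. By Abel's identity [u₁,u₂] is constant on the interval; its limit
at 0 is -1, so u₁, u₂ form a basis. -/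

noncomputable section

namespace ExceptionalLaguerre

/-! ### Entire solutions of Kummer's equation. -/

/-- `F` is an entire solution of Kummer's equation `z F'' + (b - z) F' - a F = 0`. -/
structure IsKummerSolution (a b : ℂ) (F : ℂ → ℂ) : Prop where
  differentiable : Differentiable ℂ F
  equation : ∀ z, z * deriv (deriv F) z + (b - z) * deriv F z - a * F z = 0

theorem differentiable_deriv_of_entire {F : ℂ → ℂ} (hF : Differentiable ℂ F) :
    Differentiable ℂ (deriv F) :=
  fun z => (hF.analyticAt z).deriv.differentiableAt

theorem differentiable_iteratedDeriv_of_entire {F : ℂ → ℂ} (hF : Differentiable ℂ F) (k : ℕ) :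
    Differentiable ℂ (iteratedDeriv k F) := by
  induction k with
  | zero => simpa using hF
  | succ k ih => rw [iteratedDeriv_succ]; exact differentiable_deriv_of_entire ih

/-- An entire function whose Taylor coefficients at `0` satisfy the recurrence of the Kummer series
solves Kummer's equation. -/
theorem isKummerSolution_of_iteratedDeriv {a b : ℂ} {F : ℂ → ℂ} (hF : Differentiable ℂ F)
    (h : ∀ k : ℕ, (b + k) * iteratedDeriv (k + 1) F 0 = (a + k) * iteratedDeriv k F 0) :
    IsKummerSolution a b F := by
  refine ⟨hF, ?_⟩
  set H : ℂ → ℂ := fun z => z * deriv (deriv F) z + (b - z) * deriv F z - a * F z with hH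
  -- At `z = 0` only `(b + k) F^{(k+1)}(0) - (a + k) F^{(k)}(0)` survives, so the entire function
  -- `H` has zero Taylor series.
  have hit : ∀ k, iteratedDeriv k H = fun z => z * iteratedDeriv (k + 2) F z
      + (b + k - z) * iteratedDeriv (k + 1) F z - (a + k) * iteratedDeriv k F z := by
    intro k
    induction k with
    | zero =>
      ext z
      simp [iteratedDeriv_succ, hH]
    | succ k ih =>
      rw [iteratedDeriv_succ, ih]
      ext z
      have d (j : ℕ) : HasDerivAt (iteratedDeriv j F) (iteratedDeriv (j + 1) F z) z := by
        rw [iteratedDeriv_succ]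
        exact (differentiable_iteratedDeriv_of_entire hF j z).hasDerivAt
      have := (((hasDerivAt_id z).mul (d (k + 2))).add
        (((hasDerivAt_id z).const_sub (b + k)).mul (d (k + 1)))).sub ((d k).const_mul (a + k))
      refine (this.congr_deriv ?_).deriv
      push_cast
      simp only [id]
      ring
  have hHd : Differentiable ℂ H :=
    ((differentiable_id.mul (differentiable_deriv_of_entire (differentiable_deriv_of_entire hF))).add
      (((differentiable_const b).sub differentiable_id).mul (differentiable_deriv_of_entire hF))).sub
      ((differentiable_const a).mul hF)
  intro z
  change H z = 0
  rw [← Complex.taylorSeries_eq_of_entire hHd 0 z]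
  have h0 : ∀ k, iteratedDeriv k H 0 = 0 := fun k => by
    rw [hit]
    simp [h k]
  simp [h0]

theorem isKummerSolution_of_coeff {a b : ℂ} {c : ℕ → ℂ}
    (hr : (FormalMultilinearSeries.ofScalars ℂ c).radius = ⊤)
    (h : ∀ k : ℕ, (k + 1) * (b + k) * c (k + 1) = (a + k) * c k) :
    IsKummerSolution a b (FormalMultilinearSeries.ofScalars ℂ c).sum := by
  have hs := (FormalMultilinearSeries.ofScalars ℂ c).hasFPowerSeriesOnBall (by simp [hr])
  rw [hr] at hs
  have hF : Differentiable ℂ (FormalMultilinearSeries.ofScalars ℂ c).sum := fun z =>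
    (hs.analyticAt_of_mem (by simp)).differentiableAt
  refine isKummerSolution_of_iteratedDeriv hF fun k => ?_
  have key := hs.hasFPowerSeriesAt.eq_formalMultilinearSeries (hF.analyticAt 0).hasFPowerSeriesAt
  have hc (k : ℕ) : iteratedDeriv k (FormalMultilinearSeries.ofScalars ℂ c).sum 0
      = k.factorial * c k := by
    have := congrArg (fun p => FormalMultilinearSeries.coeff p k) key
    simp only [FormalMultilinearSeries.coeff_ofScalars] at this
    rw [this]
    field_simp [Nat.factorial_ne_zero]
  rw [hc, hc, Nat.factorial_succ]
  push_cast
  linear_combination (k.factorial : ℂ) * h k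

theorem IsKummerSolution.const_mul {a b : ℂ} {F : ℂ → ℂ} (h : IsKummerSolution a b F) (C : ℂ) :
    IsKummerSolution a b (fun z => C * F z) := by
  refine ⟨h.1.const_mul C, fun z => ?_⟩
  have h1 : deriv (fun z => C * F z) = fun z => C * deriv F z := by
    ext z; exact deriv_const_mul _ (h.1 z)
  rw [h1, deriv_const_mul _ (differentiable_deriv_of_entire h.1 z)]
  linear_combination C * h.2 z

theorem isKummerSolution_kummerM (a b : ℂ) (hb : ∀ n : ℕ, b ≠ -n) :
    IsKummerSolution a b (kummerM a b) := by
  refine IsKummerSolution.const_mul ?_ _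
  refine isKummerSolution_of_coeff (Complex.radius_regularizedHGFunSeries_eq_top (by simp)) ?_
  intro k
  have hk : b + k ≠ 0 := fun h => hb k (eq_neg_of_add_eq_zero_left h)
  have hk' : (k : ℂ) + 1 ≠ 0 := Nat.cast_add_one_ne_zero k
  rw [Complex.regularizedHGFunCoeff_add_one (by simpa using hb k)]
  simp only [Multiset.map_singleton, Multiset.prod_singleton]
  field_simp

/-- The coefficients of the classical Laguerre polynomial, as complex numbers. -/
def laguerreCoeff (a : ℝ) (n k : ℕ) : ℂ :=
  if k ≤ n then
    (((-1) ^ k * (ascPochhammer ℝ (n - k)).eval (a + k + 1)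
      / ((k.factorial : ℝ) * ((n - k).factorial : ℝ)) : ℝ) : ℂ)
  else 0

/-- Checking the recurrence on coefficients extended by zero beyond `n` covers every real `a`, even
those for which ₁F₁(-n; a+1; ·) is undefined; at `k = n` both sides vanish because of the factor `-n
+ k`. -/
theorem exists_isKummerSolution_laguerrePoly (a : ℝ) (n : ℕ) :
    ∃ F : ℂ → ℂ, IsKummerSolution (-n) (a + 1) F ∧ ∀ x : ℝ, F x = laguerrePoly a n x := by
  have hzero : ∀ k, n < k → laguerreCoeff a n k = 0 := fun k hk => if_neg (by omega)
  refine ⟨_, isKummerSolution_of_coeff (c := laguerreCoeff a n) ?_ ?_, ?_⟩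
  · refine FormalMultilinearSeries.radius_eq_top_of_eventually_eq_zero _ ?_
    filter_upwards [eventually_gt_atTop n] with k hk
    rw [FormalMultilinearSeries.ofScalars_eq_zero, hzero k hk]
  · intro k
    rcases lt_trichotomy k n with hk | rfl | hk
    · obtain ⟨m, rfl⟩ : ∃ m, n = k + 1 + m := ⟨n - (k + 1), by omega⟩
      simp only [laguerreCoeff, if_pos hk.le, if_pos (Nat.succ_le_of_lt hk)]
      have e1 : k + 1 + m - k = m + 1 := by omega
      have e2 : k + 1 + m - (k + 1) = m := by omega
      rw [e1, e2, ascPochhammer_succ_left, Nat.factorial_succ, Nat.factorial_succ]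
      have hm : ((m : ℝ) + 1) ≠ 0 := Nat.cast_add_one_ne_zero m
      have hk : ((k : ℝ) + 1) ≠ 0 := Nat.cast_add_one_ne_zero k
      have hf := Nat.factorial_ne_zero
      have key : ((k : ℝ) + 1) * (a + 1 + k) * ((-1) ^ (k + 1) *
          (ascPochhammer ℝ m).eval (a + ↑(k + 1) + 1) / (((k + 1) * k.factorial : ℕ) * m.factorial))
          = (-((k + 1 + m : ℕ) : ℝ) + k) * ((-1) ^ k *
          (Polynomial.X * (ascPochhammer ℝ m).comp (Polynomial.X + 1)).eval (a + k + 1)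
            / (k.factorial * ((m + 1) * m.factorial : ℕ))) := by
        simp only [Polynomial.eval_mul, Polynomial.eval_X, Polynomial.eval_comp,
          Polynomial.eval_add, Polynomial.eval_one]
        push_cast
        rw [show a + ((k : ℝ) + 1) + 1 = a + k + 1 + 1 by ring]
        have h1 : (k.factorial : ℝ) ≠ 0 := by exact_mod_cast hf k
        have h2 : (m.factorial : ℝ) ≠ 0 := by exact_mod_cast hf m
        field_simp
        ring
      exact_mod_cast congrArg (fun t : ℝ => (t : ℂ)) key
    · rw [hzero (k + 1) (by omega)]; simp
    · rw [hzero k hk, hzero (k + 1) (by omega)]; simp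
  · intro x
    change FormalMultilinearSeries.ofScalarsSum _ _ = _
    rw [FormalMultilinearSeries.ofScalars_sum_eq,
      tsum_eq_sum (s := Finset.range (n + 1)) (fun k hk => by
        rw [hzero k (by simpa using hk), zero_smul])]
    unfold laguerrePoly
    push_cast
    refine Finset.sum_congr rfl fun k hk => ?_
    rw [laguerreCoeff, if_pos (by simpa [Nat.lt_succ_iff] using hk)]
    push_cast
    rfl

/-- Kummer's transformation. -/
theorem IsKummerSolution.exp_mul_comp_neg {a b : ℂ} {F : ℂ → ℂ} (h : IsKummerSolution a b F) :
    IsKummerSolution (b - a) b (fun z => Complex.exp z * F (-z)) := by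
  have hF' := differentiable_deriv_of_entire h.1
  have d1 (z : ℂ) : HasDerivAt (fun z => Complex.exp z * F (-z))
      (Complex.exp z * (F (-z) - deriv F (-z))) z := by
    refine ((Complex.hasDerivAt_exp z).mul
      ((h.1 (-z)).hasDerivAt.comp z (hasDerivAt_neg z))).congr_deriv ?_
    simp only [Function.comp]
    ring
  have d2 (z : ℂ) : HasDerivAt (fun z => Complex.exp z * (F (-z) - deriv F (-z)))
      (Complex.exp z * (F (-z) - 2 * deriv F (-z) + deriv (deriv F) (-z))) z := by
    refine ((Complex.hasDerivAt_exp z).mul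
      (((h.1 (-z)).hasDerivAt.comp z (hasDerivAt_neg z)).sub
        ((hF' (-z)).hasDerivAt.comp z (hasDerivAt_neg z)))).congr_deriv ?_
    simp only [Function.comp, Pi.sub_apply]
    ring
  refine ⟨fun z => (d1 z).differentiableAt, fun z => ?_⟩
  rw [show deriv (fun z => Complex.exp z * F (-z)) = _ from funext fun z => (d1 z).deriv,
    (d2 z).deriv]
  linear_combination -Complex.exp z * h.2 (-z)

/-! ### The classical Laguerre equation on (0,∞). -/

/-- `y` is an analytic solution on `(0,∞)` of the classical Laguerre equation
`-x y'' + (x - α - 1) y' = μ y`. -/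
structure IsLaguerreEigenfunction (α : ℝ) (μ : ℂ) (y : ℝ → ℂ) : Prop where
  analyticAt : ∀ x, 0 < x → AnalyticAt ℝ y x
  equation : ∀ x : ℝ, 0 < x →
    -(x : ℂ) * deriv (deriv y) x + ((x : ℂ) - α - 1) * deriv y x = μ * y x

theorem analyticAt_ofReal_rpow (e : ℝ) {x : ℝ} (hx : 0 < x) :
    AnalyticAt ℝ (fun t : ℝ => ((t ^ e : ℝ) : ℂ)) x := by
  have h : AnalyticAt ℝ (fun t : ℝ => Real.exp (Real.log t * e)) x :=
    ((analyticAt_log hx).mul analyticAt_const).rexp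
  have h2 : (fun t : ℝ => Real.exp (Real.log t * e)) =ᶠ[𝓝 x] fun t => t ^ e := by
    filter_upwards [lt_mem_nhds hx] with t ht
    rw [Real.rpow_def_of_pos ht]
  exact (Complex.ofRealCLM.analyticAt _).comp (h.congr h2)

theorem hasDerivAt_ofReal_rpow (e : ℝ) {x : ℝ} (hx : 0 < x) :
    HasDerivAt (fun t : ℝ => ((t ^ e : ℝ) : ℂ)) (((x ^ e : ℝ) : ℂ) * (e / x)) x := by
  have := (Real.hasDerivAt_rpow_const (p := e) (Or.inl hx.ne')).ofReal_comp
  refine this.congr_deriv ?_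
  rw [Real.rpow_sub_one hx.ne']
  push_cast
  ring

theorem analyticAt_comp_ofReal {F : ℂ → ℂ} (hF : Differentiable ℂ F) (x : ℝ) :
    AnalyticAt ℝ (fun t : ℝ => F t) x :=
  ((hF.analyticAt (x : ℂ)).restrictScalars (𝕜 := ℝ)).comp (Complex.ofRealCLM.analyticAt x)

/-- Conjugating with x^e produces the extra term `-e(e+α)/x`; `he`, the indicial equation at 0,
removes it and leaves Kummer's equation with parameter `α + 1 + 2e`. -/
theorem IsKummerSolution.rpow_mul {a : ℂ} {e : ℝ} {F : ℂ → ℂ} {α : ℝ}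
    (h : IsKummerSolution a (α + 1 + 2 * e) F) (he : e * (e + α) = 0) :
    IsLaguerreEigenfunction α (e - a) (fun x : ℝ => ((x ^ e : ℝ) : ℂ) * F x) := by
  have hF' := differentiable_deriv_of_entire h.1
  have d1 (x : ℝ) (hx : 0 < x) : HasDerivAt (fun x : ℝ => ((x ^ e : ℝ) : ℂ) * F x)
      (((x ^ e : ℝ) : ℂ) * (deriv F x + e / x * F x)) x := by
    refine ((hasDerivAt_ofReal_rpow e hx).mul (h.1 x).hasDerivAt.comp_ofReal).congr_deriv ?_
    ring
  have d2 (x : ℝ) (hx : 0 < x) :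
      HasDerivAt (fun x : ℝ => ((x ^ e : ℝ) : ℂ) * (deriv F x + e / x * F x))
      (((x ^ e : ℝ) : ℂ) * (deriv (deriv F) x + 2 * e / x * deriv F x
        + e * (e - 1) / x ^ 2 * F x)) x := by
    have hx' : (x : ℂ) ≠ 0 := by exact_mod_cast hx.ne'
    have hid : HasDerivAt (fun t : ℝ => (e : ℂ) / (t : ℂ)) (-e / x ^ 2) x := by
      have := ((hasDerivAt_id (x : ℂ)).inv hx').const_mul (e : ℂ)
      refine (this.comp_ofReal.congr_deriv ?_).congr_of_eventuallyEq
        (Eventually.of_forall fun t => ?_)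
      · simp; ring
      · simp [div_eq_mul_inv]
    refine ((hasDerivAt_ofReal_rpow e hx).mul ((hF' x).hasDerivAt.comp_ofReal.add
      (hid.mul (h.1 x).hasDerivAt.comp_ofReal))).congr_deriv ?_
    simp only [Pi.add_apply, Pi.mul_apply]
    field_simp
    ring
  refine ⟨fun x hx => (analyticAt_ofReal_rpow e hx).mul (analyticAt_comp_ofReal h.1 x),
    fun x hx => ?_⟩
  have hx' : (x : ℂ) ≠ 0 := by exact_mod_cast hx.ne'
  have e2 : deriv (fun x : ℝ => ((x ^ e : ℝ) : ℂ) * F x) =ᶠ[𝓝 x]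
      fun x : ℝ => ((x ^ e : ℝ) : ℂ) * (deriv F x + e / x * F x) := by
    filter_upwards [lt_mem_nhds hx] with t ht
    exact (d1 t ht).deriv
  rw [e2.deriv_eq, (d1 x hx).deriv, (d2 x hx).deriv]
  have he' : (e : ℂ) * (e + α) = 0 := by exact_mod_cast he
  have := h.2 x
  field_simp
  linear_combination (-((x ^ e : ℝ) : ℂ) * x) * this - ((x ^ e : ℝ) : ℂ) * F x * he'

/-- The derivatives of a solution of the Laguerre equation. -/
theorem IsLaguerreEigenfunction.iteratedDeriv_equation {α : ℝ} {μ : ℂ} {y : ℝ → ℂ}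
    (h : IsLaguerreEigenfunction α μ y) (k : ℕ) : ∀ x : ℝ, 0 < x →
    -(x : ℂ) * iteratedDeriv (k + 2) y x + ((x : ℂ) - α - 1 - k) * iteratedDeriv (k + 1) y x
      + k * iteratedDeriv k y x = μ * iteratedDeriv k y x := by
  have d (j : ℕ) (x : ℝ) (hx : 0 < x) :
      HasDerivAt (iteratedDeriv j y) (iteratedDeriv (j + 1) y x) x := by
    rw [iteratedDeriv_succ, iteratedDeriv_eq_iterate]
    exact ((h.1 x hx).iterated_deriv j).differentiableAt.hasDerivAt
  induction k with
  | zero =>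
    intro x hx
    simpa [iteratedDeriv_succ] using h.2 x hx
  | succ k ih =>
    intro x hx
    have hid : HasDerivAt (fun t : ℝ => (t : ℂ)) 1 x := HasDerivAt.ofReal_comp (hasDerivAt_id x)
    have h1 := ((hid.neg.mul (d (k + 2) x hx)).add
      ((((hid.sub_const (α : ℂ)).sub_const 1).sub_const (k : ℂ)).mul (d (k + 1) x hx))).add
        ((d k x hx).const_mul (k : ℂ))
    have h2 := (d k x hx).const_mul μ
    have h3 := h1.congr_of_eventuallyEq (f₁ := fun t => μ * iteratedDeriv k y t) (by
      filter_upwards [lt_mem_nhds hx] with t ht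
      exact (ih t ht).symm)
    have := h3.unique h2
    simp only [Pi.neg_apply] at this
    push_cast
    linear_combination this

/-! ### Expansions at 0 and the order of a Wronskian there. -/

theorem eventuallyEq_deriv_nhdsGT {f g : ℝ → ℂ} {a : ℝ} (h : f =ᶠ[𝓝[>] a] g) :
    deriv f =ᶠ[𝓝[>] a] deriv g := by
  have h' := eventually_eventually_nhdsWithin.2 h
  filter_upwards [h', self_mem_nhdsWithin] with x hx hax
  rw [IsOpen.nhdsWithin_eq isOpen_Ioi hax] at hx
  exact EventuallyEq.deriv_eq hx

/-- Repeated division by `x` through `dslope`; the identity is therefore exact for all real `x`,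
while `h` is controlled only at 0. -/
theorem exists_taylor_expansion {g : ℝ → ℂ} (hg : AnalyticAt ℝ g 0) (n : ℕ) :
    ∃ (c : ℕ → ℂ) (h : ℝ → ℂ), AnalyticAt ℝ h 0 ∧
      ∀ x : ℝ, g x = ∑ k ∈ Finset.range n, c k * (x : ℂ) ^ k + (x : ℂ) ^ n * h x := by
  induction n with
  | zero => exact ⟨0, g, hg, fun x => by simp⟩
  | succ n ih =>
    obtain ⟨c, h, hh, hx⟩ := ih
    obtain ⟨p, hp⟩ := hh
    refine ⟨Function.update c n (h 0), dslope h 0, ⟨_, hp.has_fpower_series_dslope_fslope⟩,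
      fun x => ?_⟩
    have h1 := sub_smul_dslope h 0 x
    rw [sub_zero, Complex.real_smul] at h1
    rw [Finset.sum_range_succ, Function.update_self, hx x]
    have h2 : ∑ k ∈ Finset.range n, Function.update c n (h 0) k * (x : ℂ) ^ k
        = ∑ k ∈ Finset.range n, c k * (x : ℂ) ^ k :=
      Finset.sum_congr rfl fun k hk => by
        rw [Function.update_of_ne (Finset.mem_range.1 hk).ne]
    rw [h2]
    linear_combination (-(x : ℂ) ^ n) * h1

/-- The falling factorial `t (t - 1) ⋯ (t - i + 1)`. -/
def fallingFactor (t : ℝ) (i : ℕ) : ℂ := ∏ l ∈ Finset.range i, ((t : ℂ) - l)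

/-- Termwise differentiation of x^{e+k}. Each coefficient is `c k` times a factor depending only on
`e + k` and `i`; this is what makes columns proportional in `exists_det_eq_pow_mul`. -/
theorem exists_iteratedDeriv_expansion {F g : ℝ → ℂ} {e : ℝ} {n : ℕ} {c : ℕ → ℂ}
    (hg : AnalyticAt ℝ g 0)
    (hF : ∀ᶠ x : ℝ in 𝓝[>] 0, F x = ((x ^ e : ℝ) : ℂ) *
      (∑ k ∈ Finset.range n, c k * (x : ℂ) ^ k + (x : ℂ) ^ n * g x)) (i : ℕ) :
    ∃ h : ℝ → ℂ, AnalyticAt ℝ h 0 ∧ ∀ᶠ x : ℝ in 𝓝[>] 0, iteratedDeriv i F x =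
      ((x ^ (e - i) : ℝ) : ℂ) * (∑ k ∈ Finset.range n, fallingFactor (e + k) i * c k * (x : ℂ) ^ k
        + (x : ℂ) ^ n * h x) := by
  induction i with
  | zero => exact ⟨g, hg, by simpa [fallingFactor] using hF⟩
  | succ i ih =>
    obtain ⟨h, hh, hev⟩ := ih
    refine ⟨fun x => (e - i + n : ℂ) * h x + x * deriv h x,
      (analyticAt_const.mul hh).add ((Complex.ofRealCLM.analyticAt _).mul hh.deriv), ?_⟩
    rw [iteratedDeriv_succ]
    have h0 : ∀ᶠ x in 𝓝[>] (0 : ℝ), AnalyticAt ℝ h x :=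
      hh.eventually_analyticAt.filter_mono nhdsWithin_le_nhds
    filter_upwards [eventuallyEq_deriv_nhdsGT hev, h0, self_mem_nhdsWithin] with x hx hhx hx0
    have hx0 : 0 < x := hx0
    rw [hx]
    have hid : HasDerivAt (fun t : ℝ => (t : ℂ)) 1 x := HasDerivAt.ofReal_comp (hasDerivAt_id x)
    have hsum : HasDerivAt
        (fun t : ℝ => ∑ k ∈ Finset.range n, fallingFactor (e + k) i * c k * (t : ℂ) ^ k)
        (∑ k ∈ Finset.range n, fallingFactor (e + k) i * c k * (k * (x : ℂ) ^ (k - 1) * 1)) x :=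
      HasDerivAt.fun_sum fun k _ => (hid.pow k).const_mul _
    have hd := (hasDerivAt_ofReal_rpow (e - i) hx0).mul
      (hsum.add ((hid.pow n).mul hhx.differentiableAt.hasDerivAt))
    have hx' : (x : ℂ) ≠ 0 := by exact_mod_cast hx0.ne'
    have hp (m : ℕ) : (x : ℂ) * (m * (x : ℂ) ^ (m - 1) * 1) = m * (x : ℂ) ^ m := by
      cases m with
      | zero => simp
      | succ m => simp [pow_succ]; ring
    rw [show (e - (i + 1 : ℕ) : ℝ) = e - i - 1 by push_cast; ring, Real.rpow_sub_one hx0.ne']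
    refine hd.deriv.trans ?_
    simp only [Pi.add_apply, Pi.mul_apply, Pi.pow_apply]
    have hs : ∑ k ∈ Finset.range n, fallingFactor (e + k) (i + 1) * c k * (x : ℂ) ^ k
        = (e - i) * ∑ k ∈ Finset.range n, fallingFactor (e + k) i * c k * (x : ℂ) ^ k
          + x * ∑ k ∈ Finset.range n,
            fallingFactor (e + k) i * c k * (k * (x : ℂ) ^ (k - 1) * 1) := by
      rw [Finset.mul_sum, Finset.mul_sum, ← Finset.sum_add_distrib]
      refine Finset.sum_congr rfl fun k _ => ?_
      rw [fallingFactor, Finset.prod_range_succ, ← fallingFactor]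
      push_cast
      linear_combination (-fallingFactor (e + k) i * c k) * hp k
    rw [hs]
    push_cast
    field_simp
    linear_combination (x ^ (e - i) : ℝ) * h x * hp n

/-- A set of `m + 1` naturals contains an element `≥ m`; remove it and induct. -/
theorem sum_range_card_le_sum (T : Finset ℕ) : ∑ i ∈ Finset.range T.card, i ≤ ∑ i ∈ T, i := by
  obtain ⟨m, hm⟩ : ∃ m, T.card = m := ⟨_, rfl⟩
  induction m generalizing T with
  | zero => simp [hm]
  | succ m ih =>
    obtain ⟨a, ha, hma⟩ : ∃ a ∈ T, m ≤ a := by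
      by_contra! h
      have := Finset.card_le_card (show T ⊆ Finset.range m from fun a ha => Finset.mem_range.2 (h a ha))
      simp at this
      omega
    have hc : (T.erase a).card = m := by rw [Finset.card_erase_of_mem ha, hm]; rfl
    have := ih (T.erase a) hc
    rw [hc] at this
    rw [hm, Finset.sum_range_succ, ← Finset.sum_erase_add _ _ ha]
    omega

theorem sum_range_card_le_sum_of_injOn {ι : Type*} (S : Finset ι) (κ : ι → ℕ)
    (h : Set.InjOn κ S) : ∑ i ∈ Finset.range S.card, i ≤ ∑ j ∈ S, κ j := by
  classical
  have := sum_range_card_le_sum (S.image κ)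
  rwa [Finset.sum_image h, Finset.card_image_of_injOn h] at this

/-- The exponent of a column: `-α` for columns `x^{-α} g` and `0` for columns `g`. -/
def columnExponent (α : ℝ) (s : Bool) : ℝ := if s then -α else 0

theorem analyticAt_det {n : ℕ} {A : Fin n → Fin n → ℝ → ℂ} {x : ℝ}
    (h : ∀ i j, AnalyticAt ℝ (A i j) x) :
    AnalyticAt ℝ (fun t => (Matrix.of fun i j => A i j t).det) x := by
  simp only [Matrix.det_apply']
  refine Finset.analyticAt_fun_sum _ fun σ _ => analyticAt_const.mul ?_
  exact Finset.analyticAt_fun_prod _ fun i _ => h _ _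

/-- The determinant is expanded multilinearly, one power of `x` being chosen for each `j`. Choices
of total degree below `K` contribute nothing: two functions of the same type must then use the same
power, and their vectors of falling factorials are proportional. Every other term is divisible by `x
^ K`. -/
theorem exists_det_eq_pow_mul {N K : ℕ} {α : ℝ} (σ : Fin N → Bool)
    (hK : K = ∑ i ∈ Finset.range (Finset.univ.filter fun j => σ j = false).card, i
      + ∑ i ∈ Finset.range (Finset.univ.filter fun j => σ j = true).card, i)
    (c : Fin N → ℕ → ℂ) (h : Fin N → Fin N → ℝ → ℂ) (hh : ∀ j i, AnalyticAt ℝ (h j i) 0) :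
    ∃ G : ℝ → ℂ, AnalyticAt ℝ G 0 ∧ ∀ x : ℝ,
      (Matrix.of fun j i : Fin N => ∑ k ∈ Finset.range K,
        fallingFactor (columnExponent α (σ j) + k) i * c j k * (x : ℂ) ^ k
          + (x : ℂ) ^ K * h j i x).det = (x : ℂ) ^ K * G x := by
  -- The index `k = K` stands for the remainder term; it is never chosen when the total degree is
  -- below `K`.
  let ψ : Fin N → Fin (K + 1) → Fin N → ℝ → ℂ := fun j k i x =>
    if (k : ℕ) < K then fallingFactor (columnExponent α (σ j) + (k : ℕ)) i * c j k else h j i x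
  have hψ (j k i) : AnalyticAt ℝ (ψ j k i) 0 := by
    by_cases hk : (k : ℕ) < K
    · simp only [ψ, hk, if_true]; exact analyticAt_const
    · simp only [ψ, hk, if_false]; exact hh j i
  have hexp (x : ℝ) : (Matrix.of fun j i : Fin N => ∑ k ∈ Finset.range K,
        fallingFactor (columnExponent α (σ j) + k) i * c j k * (x : ℂ) ^ k
          + (x : ℂ) ^ K * h j i x).det
      = ∑ κ : Fin N → Fin (K + 1), (x : ℂ) ^ (∑ j, (κ j : ℕ)) *
        (Matrix.of fun j i => ψ j (κ j) i x).det := by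
    have h1 := MultilinearMap.map_sum (Matrix.detRowAlternating (n := Fin N) (R := ℂ)).toMultilinearMap
      (fun (j : Fin N) (k : Fin (K + 1)) (i : Fin N) => (x : ℂ) ^ (k : ℕ) * ψ j k i x)
    have h2 : (fun j : Fin N => ∑ k : Fin (K + 1),
        (fun (i : Fin N) => (x : ℂ) ^ (k : ℕ) * ψ j k i x)) = (Matrix.of fun j i : Fin N =>
          ∑ k ∈ Finset.range K,
          fallingFactor (columnExponent α (σ j) + k) i * c j k * (x : ℂ) ^ k
          + (x : ℂ) ^ K * h j i x) := by
      ext j i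
      rw [Finset.sum_apply, Fin.sum_univ_castSucc, Matrix.of_apply, ← Fin.sum_univ_eq_sum_range
        (fun k => fallingFactor (columnExponent α (σ j) + k) i * c j k * (x : ℂ) ^ k) K]
      congr 1
      · refine Finset.sum_congr rfl fun k _ => ?_
        simp [ψ]
        ring
      · simp [ψ]
    rw [h2] at h1
    refine h1.trans (Finset.sum_congr rfl fun κ _ => ?_)
    rw [← Finset.prod_pow_eq_pow_sum, ← Matrix.det_mul_column]
    rfl
  have hzero (κ : Fin N → Fin (K + 1)) (hκ : ¬ K ≤ ∑ j, (κ j : ℕ)) (x : ℝ) :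
      (Matrix.of fun j i => ψ j (κ j) i x).det = 0 := by
    have hlt (j) : (κ j : ℕ) < K :=
      (Finset.single_le_sum (f := fun j => (κ j : ℕ)) (fun _ _ => Nat.zero_le _)
        (Finset.mem_univ j)).trans_lt (not_le.1 hκ)
    -- Pigeonhole: if `κ` were injective on each of the two types, its sum would be at least
    -- (0+⋯+(p-1)) + (0+⋯+(s-1)) = `K`, where p and s count the two types.
    obtain ⟨j, j', hjj, hσ, hk⟩ : ∃ j j', j ≠ j' ∧ σ j = σ j' ∧ (κ j : ℕ) = κ j' := by
      by_contra! hcon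
      apply hκ
      have hinj (s : Bool) : Set.InjOn (fun j => (κ j : ℕ))
          (Finset.univ.filter fun j => σ j = s : Finset (Fin N)) := by
        intro a ha b hb hab
        by_contra hne
        exact hcon a b hne (by simp at ha hb; rw [ha, hb]) hab
      have h1 := sum_range_card_le_sum_of_injOn _ _ (hinj false)
      have h2 := sum_range_card_le_sum_of_injOn _ _ (hinj true)
      have h3 := Finset.sum_filter_add_sum_filter_not Finset.univ (fun j => σ j = false)
        (fun j => (κ j : ℕ))
      simp only [Bool.not_eq_false] at h3
      omega
    have e1 : (Matrix.of fun j i => ψ j (κ j) i x) = Matrix.of fun j i => c j (κ j) *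
        (Matrix.of fun j i : Fin N =>
          fallingFactor (columnExponent α (σ j) + (κ j : ℕ)) i) j i := by
      ext j i
      simp only [ψ, hlt j, if_true, Matrix.of_apply]
      ring
    rw [e1, Matrix.det_mul_column, Matrix.det_zero_of_row_eq hjj, mul_zero]
    ext i
    simp [hσ, hk]
  refine ⟨fun x => ∑ κ : Fin N → Fin (K + 1), if K ≤ ∑ j, (κ j : ℕ) then
    (x : ℂ) ^ (∑ j, (κ j : ℕ) - K) * (Matrix.of fun j i => ψ j (κ j) i x).det else 0, ?_, ?_⟩
  · refine Finset.analyticAt_fun_sum _ fun κ _ => ?_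
    split_ifs
    · exact ((Complex.ofRealCLM.analyticAt _).pow _).mul (analyticAt_det fun j i => hψ _ _ _)
    · exact analyticAt_const
  · intro x
    rw [hexp, Finset.mul_sum]
    refine Finset.sum_congr rfl fun κ _ => ?_
    split_ifs with hκ
    · rw [← mul_assoc, ← pow_add, Nat.add_sub_cancel' hκ]
    · rw [hzero κ hκ, mul_zero, mul_zero]

/-- The Wronskian of `p` analytic functions and `s` functions of the form `x^{-α} g` with `g`
analytic is `x^{-(α+p)s}` times an analytic function. -/
theorem exists_analyticAt_wronskian {N : ℕ} {α : ℝ} (σ : Fin N → Bool) (F g : Fin N → ℝ → ℂ)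
    (hg : ∀ j, AnalyticAt ℝ (g j) 0)
    (hF : ∀ j, ∀ᶠ x : ℝ in 𝓝[>] 0, F j x = ((x ^ columnExponent α (σ j) : ℝ) : ℂ) * g j x) :
    ∃ G : ℝ → ℂ, AnalyticAt ℝ G 0 ∧ ∀ᶠ x : ℝ in 𝓝[>] 0,
      ((x ^ ((α + (Finset.univ.filter fun j => σ j = false).card)
        * (Finset.univ.filter fun j => σ j = true).card) : ℝ) : ℂ) * wronskian F x = G x := by
  set p := (Finset.univ.filter fun j => σ j = false).card with hp
  set s := (Finset.univ.filter fun j => σ j = true).card with hs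
  set K := ∑ i ∈ Finset.range p, i + ∑ i ∈ Finset.range s, i with hK
  have hN : N = p + s := by
    have := Finset.card_filter_add_card_filter_not (s := (Finset.univ : Finset (Fin N)))
      (fun j => σ j = false)
    simp only [Bool.not_eq_false, Finset.card_univ, Fintype.card_fin] at this
    exact this.symm
  choose c g' hg' hc using fun j => exists_taylor_expansion (hg j) K
  have hF' (j : Fin N) := (hF j).mono fun x hx => hx.trans (by rw [hc j x])
  choose h hh hev using fun (j i : Fin N) => exists_iteratedDeriv_expansion (hg' j) (hF' j) i
  obtain ⟨G, hG, hdet⟩ := exists_det_eq_pow_mul (α := α) σ hK c h hh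
  refine ⟨G, hG, ?_⟩
  filter_upwards [eventually_all.2 fun j => eventually_all.2 (hev j), self_mem_nhdsWithin]
    with x hx hx0
  have hx0 : 0 < x := hx0
  -- The columns contribute -αs, the rows -N(N-1)/2 and the determinant `K` = p(p-1)/2 + s(s-1)/2.
  -- With N = p + s the total is -(α+p)s.
  have e1 : wronskian F x = ((x ^ (-((α + p) * s)) : ℝ) : ℂ) * G x := by
    unfold wronskian
    rw [← Matrix.det_transpose]
    have e2 : (Matrix.of fun i j : Fin N => iteratedDeriv (i : ℕ) (F j) x).transpose
        = Matrix.of fun j i : Fin N => ((x ^ columnExponent α (σ j) : ℝ) : ℂ) *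
          (Matrix.of fun j i : Fin N => ((x ^ (-(i : ℝ)) : ℝ) : ℂ) *
            (Matrix.of fun j i : Fin N => ∑ k ∈ Finset.range K,
              fallingFactor (columnExponent α (σ j) + k) i * c j k * (x : ℂ) ^ k
                + (x : ℂ) ^ K * h j i x) j i) j i := by
      ext j i
      simp only [Matrix.transpose_apply, Matrix.of_apply, hx j i]
      rw [sub_eq_add_neg, Real.rpow_add hx0]
      push_cast
      ring
    rw [e2, Matrix.det_mul_column, Matrix.det_mul_row, hdet, ← mul_assoc, ← mul_assoc]
    congr 1
    rw [← Complex.ofReal_prod, ← Complex.ofReal_prod, ← Complex.ofReal_pow, ← Complex.ofReal_mul,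
      ← Complex.ofReal_mul, ← Real.rpow_natCast, ← Real.rpow_sum_of_pos hx0,
      ← Real.rpow_sum_of_pos hx0, ← Real.rpow_add hx0, ← Real.rpow_add hx0]
    congr 2
    have s1 : ∑ j, columnExponent α (σ j) = -α * s := by
      simp only [columnExponent]
      rw [Finset.sum_ite, Finset.sum_const, Finset.sum_const_zero, nsmul_eq_mul, ← hs]
      ring
    have gauss (n : ℕ) : ((∑ i ∈ Finset.range n, i : ℕ) : ℝ) = n * (n - 1) / 2 := by
      induction n with
      | zero => simp
      | succ n ih => rw [Finset.sum_range_succ]; push_cast at ih ⊢; rw [ih]; ring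
    have s2 : ∑ i : Fin N, -((i : ℕ) : ℝ) = -(N * (N - 1) / 2) := by
      rw [Finset.sum_neg_distrib, Fin.sum_univ_eq_sum_range (fun i => (i : ℝ)), ← gauss]
      push_cast
      rfl
    rw [s1, s2, hK, Nat.cast_add, gauss, gauss, hN]
    push_cast
    ring
  rw [e1, ← mul_assoc, ← Complex.ofReal_mul, ← Real.rpow_add hx0]
  simp

/-! ### Derivatives and cofactor expansion of Wronskians. -/

theorem analyticAt_iteratedDeriv {f : ℝ → ℂ} {x : ℝ} (hf : AnalyticAt ℝ f x) (k : ℕ) :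
    AnalyticAt ℝ (iteratedDeriv k f) x := by
  rw [iteratedDeriv_eq_iterate]
  exact hf.iterated_deriv k

theorem hasDerivAt_iteratedDeriv {f : ℝ → ℂ} {x : ℝ} (hf : AnalyticAt ℝ f x) (k : ℕ) :
    HasDerivAt (iteratedDeriv k f) (iteratedDeriv (k + 1) f x) x := by
  rw [iteratedDeriv_succ]
  exact (analyticAt_iteratedDeriv hf k).differentiableAt.hasDerivAt

theorem hasDerivAt_det {n : ℕ} {A : ℝ → Matrix (Fin n) (Fin n) ℂ} {A' : Matrix (Fin n) (Fin n) ℂ}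
    {x : ℝ} (h : ∀ i j, HasDerivAt (fun t => A t i j) (A' i j) x) :
    HasDerivAt (fun t => (A t).det) (∑ i, ((A x).updateRow i (A' i)).det) x := by
  let D : ContinuousMultilinearMap ℂ (fun _ : Fin n => Fin n → ℂ) ℂ :=
    { (Matrix.detRowAlternating (n := Fin n) (R := ℂ)).toMultilinearMap with
      cont := by
        change Continuous fun M : Matrix (Fin n) (Fin n) ℂ => M.det
        exact continuous_id.matrix_det }
  have hA : HasDerivAt (F := Fin n → Fin n → ℂ) A A' x :=
    hasDerivAt_pi.2 fun i => hasDerivAt_pi.2 fun j => h i j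
  have h1 := ((D.hasFDerivAt (A x)).restrictScalars ℝ).comp_hasDerivAt x hA
  refine h1.congr_deriv ?_
  exact ContinuousMultilinearMap.linearDeriv_apply D (A x) A'

/-- The coefficient of `y^{(k)}` in the Wronskian `Wr[f₁,…,f_r,y]`. -/
def wronskianMinor {r : ℕ} (f : Fin r → ℝ → ℂ) (k : ℕ) (x : ℝ) : ℂ :=
  (-1) ^ (k + r) * (Matrix.of fun i j : Fin r =>
    iteratedDeriv (if (i : ℕ) < k then i else i + 1) (f j) x).det

theorem wronskian_snoc {r : ℕ} (f : Fin r → ℝ → ℂ) (y : ℝ → ℂ) (x : ℝ) :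
    wronskian (Fin.snoc (α := fun _ => ℝ → ℂ) f y) x
      = ∑ k ∈ Finset.range (r + 1), wronskianMinor f k x * iteratedDeriv k y x := by
  rw [wronskian, Matrix.det_succ_column _ (Fin.last r),
    ← Fin.sum_univ_eq_sum_range (fun k => wronskianMinor f k x * iteratedDeriv k y x)]
  refine Finset.sum_congr rfl fun k _ => ?_
  simp only [Matrix.of_apply, Fin.snoc_last, Fin.val_last, wronskianMinor]
  have : ((Matrix.of fun i j : Fin (r + 1) =>
      iteratedDeriv (i : ℕ) (Fin.snoc (α := fun _ => ℝ → ℂ) f y j) x).submatrix k.succAbove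
        (Fin.last r).succAbove) = Matrix.of fun i j : Fin r =>
          iteratedDeriv (if (i : ℕ) < k then (i : ℕ) else i + 1) (f j) x := by
    ext i j
    simp only [Matrix.submatrix_apply, Matrix.of_apply, Fin.succAbove_last, Fin.snoc_castSucc]
    congr 1
    simp only [Fin.succAbove, Fin.lt_def, Fin.val_castSucc]
    split_ifs <;> simp
  rw [this]
  ring

theorem wronskianMinor_self {r : ℕ} (f : Fin r → ℝ → ℂ) (x : ℝ) :
    wronskianMinor f r x = wronskian f x := by
  rw [wronskianMinor, ← two_mul, pow_mul]
  simp [wronskian]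

/-- Differentiating any row but the last duplicates the next row, so one determinant survives. Hence
the coefficient of the second highest derivative in Wr[f₁,…,f_r,y] is minus the derivative of the
leading one. -/
theorem hasDerivAt_wronskian {r : ℕ} (f : Fin (r + 1) → ℝ → ℂ) {x : ℝ}
    (hf : ∀ j, AnalyticAt ℝ (f j) x) :
    HasDerivAt (wronskian f) (-wronskianMinor f r x) x := by
  have h := hasDerivAt_det (A := fun t => Matrix.of fun i j : Fin (r + 1) =>
    iteratedDeriv (i : ℕ) (f j) t) (A' := Matrix.of fun i j : Fin (r + 1) =>
      iteratedDeriv (i + 1 : ℕ) (f j) x) (x := x) fun i j => hasDerivAt_iteratedDeriv (hf j) i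
  refine h.congr_deriv ?_
  rw [Finset.sum_eq_single (Fin.last r)]
  · have e : -wronskianMinor f r x = (Matrix.of fun i j : Fin (r + 1) =>
        iteratedDeriv (if (i : ℕ) < r then (i : ℕ) else i + 1) (f j) x).det := by
      rw [wronskianMinor, show r + (r + 1) = 2 * r + 1 by ring, pow_succ, pow_mul]
      simp
    rw [e]
    congr 1
    ext i j
    by_cases hi : i = Fin.last r
    · subst hi; simp
    · have : (i : ℕ) < r := by
        have := Fin.val_lt_last hi
        simpa using this
      simp [Matrix.updateRow_ne hi, this]
  · intro i _ hi
    have hlt : (i : ℕ) < r := Fin.val_lt_last hi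
    refine Matrix.det_zero_of_row_eq (i := i) (j := ⟨i + 1, by omega⟩)
      (fun h => by simpa using congrArg Fin.val h) ?_
    rw [Matrix.updateRow_self, Matrix.updateRow_ne (fun h => by simpa using congrArg Fin.val h)]
    rfl
  · simp

theorem analyticAt_wronskianMinor {r : ℕ} {f : Fin r → ℝ → ℂ} {x : ℝ}
    (hf : ∀ j, AnalyticAt ℝ (f j) x) (k : ℕ) : AnalyticAt ℝ (wronskianMinor f k) x :=
  analyticAt_const.mul (analyticAt_det fun _ j => analyticAt_iteratedDeriv (hf j) _)

theorem analyticAt_wronskian {r : ℕ} {f : Fin r → ℝ → ℂ} {x : ℝ}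
    (hf : ∀ j, AnalyticAt ℝ (f j) x) : AnalyticAt ℝ (wronskian f) x :=
  analyticAt_det fun _ j => analyticAt_iteratedDeriv (hf j) _

theorem wronskian_snoc_self {r : ℕ} (f : Fin r → ℝ → ℂ) (j : Fin r) (x : ℝ) :
    wronskian (Fin.snoc (α := fun _ => ℝ → ℂ) f (f j)) x = 0 :=
  Matrix.det_zero_of_column_eq (i := j.castSucc) (j := Fin.last r) (Fin.castSucc_lt_last j).ne
    (fun k => by simp)

/-! ### Differential operators and Crum's theorem. -/

/-- The differential operator `∑_{k ≤ r} c_k ∂^k`. -/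
def diffOp (r : ℕ) (c : ℕ → ℝ → ℂ) (y : ℝ → ℂ) (x : ℝ) : ℂ :=
  ∑ k ∈ Finset.range (r + 1), c k x * iteratedDeriv k y x

theorem hasDerivAt_diffOp {r : ℕ} {c : ℕ → ℝ → ℂ} {y : ℝ → ℂ} {x : ℝ}
    (hc : ∀ k, AnalyticAt ℝ (c k) x) (hy : AnalyticAt ℝ y x) :
    HasDerivAt (diffOp r c y) (diffOp r (fun k => deriv (c k)) y x + diffOp r c (deriv y) x) x := by
  have h : HasDerivAt (diffOp r c y) (∑ k ∈ Finset.range (r + 1),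
      (deriv (c k) x * iteratedDeriv k y x + c k x * iteratedDeriv (k + 1) y x)) x :=
    HasDerivAt.fun_sum fun k _ =>
      (hc k).differentiableAt.hasDerivAt.mul (hasDerivAt_iteratedDeriv hy k)
  refine h.congr_deriv ?_
  rw [Finset.sum_add_distrib]
  simp only [diffOp, iteratedDeriv_succ']

theorem analyticAt_diffOp {r : ℕ} {c : ℕ → ℝ → ℂ} {y : ℝ → ℂ} {x : ℝ}
    (hc : ∀ k, AnalyticAt ℝ (c k) x) (hy : AnalyticAt ℝ y x) : AnalyticAt ℝ (diffOp r c y) x :=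
  Finset.analyticAt_fun_sum _ fun k _ => (hc k).mul (analyticAt_iteratedDeriv hy k)

theorem deriv_deriv_diffOp {r : ℕ} {c : ℕ → ℝ → ℂ} {y : ℝ → ℂ} {x : ℝ}
    (hc : ∀ k, AnalyticAt ℝ (c k) x) (hy : AnalyticAt ℝ y x) :
    deriv (deriv (diffOp r c y)) x = diffOp r (fun k => deriv (deriv (c k))) y x
      + 2 * diffOp r (fun k => deriv (c k)) (deriv y) x + diffOp r c (deriv (deriv y)) x := by
  have hev : ∀ᶠ t in 𝓝 x, AnalyticAt ℝ y t ∧ ∀ k ∈ Finset.range (r + 1), AnalyticAt ℝ (c k) t :=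
    hy.eventually_analyticAt.and
      ((Finset.eventually_all _).2 fun k _ => (hc k).eventually_analyticAt)
  have h1 : deriv (diffOp r c y) =ᶠ[𝓝 x]
      diffOp r (fun k => deriv (c k)) y + diffOp r c (deriv y) := by
    filter_upwards [hev] with t ht
    have h : HasDerivAt (diffOp r c y) (∑ k ∈ Finset.range (r + 1),
        (deriv (c k) t * iteratedDeriv k y t + c k t * iteratedDeriv (k + 1) y t)) t :=
      HasDerivAt.fun_sum fun k hk =>
        (ht.2 k hk).differentiableAt.hasDerivAt.mul (hasDerivAt_iteratedDeriv ht.1 k)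
    rw [h.deriv, Finset.sum_add_distrib]
    simp only [Pi.add_apply, diffOp, iteratedDeriv_succ']
  rw [h1.deriv_eq, ((hasDerivAt_diffOp (fun k => (hc k).deriv) hy).add
    (hasDerivAt_diffOp hc hy.deriv)).deriv]
  ring

/-- Shift of a sequence by one to the right. -/
def shiftSeq (a : ℕ → ℂ) : ℕ → ℂ
  | 0 => 0
  | k + 1 => a k

/-- The commutator of a differential operator with the Laguerre operator, evaluated on an
eigenfunction. -/
theorem IsLaguerreEigenfunction.diffOp_commutator {α : ℝ} {μ : ℂ} {y : ℝ → ℂ}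
    (hy : IsLaguerreEigenfunction α μ y) {r : ℕ} {c : ℕ → ℝ → ℂ} {x : ℝ} (hx : 0 < x)
    (hc : ∀ k, AnalyticAt ℝ (c k) x) {β γ : ℂ} {A B : ℕ → ℂ}
    (hA : ∀ k, A k = -x * deriv (deriv (c k)) x + β * deriv (c k) x + γ * c k x - k * c k x)
    (hB : ∀ k, B k = -2 * x * deriv (c k) x + β * c k x - (x - α - 1 - k) * c k x)
    (hr1 : B r = 0) (hr0 : A r + shiftSeq B r = 0) :
    -(x : ℂ) * deriv (deriv (diffOp r c y)) x + β * deriv (diffOp r c y) x + γ * diffOp r c y x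
      - μ * diffOp r c y x
      = ∑ k ∈ Finset.range r, (A k + shiftSeq B k) * iteratedDeriv k y x := by
  have hya := hy.1 x hx
  have h1 : ∑ k ∈ Finset.range r, (A k + shiftSeq B k) * iteratedDeriv k y x
      = ∑ k ∈ Finset.range (r + 1), (A k * iteratedDeriv k y x
        + B k * iteratedDeriv (k + 1) y x) := by
    have e1 : ∑ k ∈ Finset.range (r + 1), B k * iteratedDeriv (k + 1) y x
        = ∑ k ∈ Finset.range (r + 1), shiftSeq B k * iteratedDeriv k y x := by
      rw [Finset.sum_range_succ, Finset.sum_range_succ', hr1]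
      simp [shiftSeq]
    rw [Finset.sum_add_distrib, e1, ← Finset.sum_add_distrib, Finset.sum_range_succ]
    simp only [← add_mul]
    rw [hr0]
    ring
  rw [h1, deriv_deriv_diffOp hc hya, (hasDerivAt_diffOp hc hya).deriv]
  simp only [diffOp, mul_add, Finset.mul_sum, ← Finset.sum_add_distrib, ← Finset.sum_sub_distrib,
    ← iteratedDeriv_succ']
  refine Finset.sum_congr rfl fun k _ => ?_
  -- Replacing `-x y^{(k+2)}` by the differentiated equation also cancels the `μ y^{(k)}` term, so
  -- neither `A` nor `B` depends on the eigenvalue.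
  have := hy.iteratedDeriv_equation k x hx
  rw [hA, hB]
  linear_combination (c k x) * this

/-- **Crum's theorem**: a differential operator annihilating the seed functions intertwines the
Laguerre operator with the second order operator determined by its two leading coefficients. -/
theorem IsLaguerreEigenfunction.diffOp_eigen {α : ℝ} {μ : ℂ} {y : ℝ → ℂ}
    (hy : IsLaguerreEigenfunction α μ y) {r : ℕ} {f : Fin r → ℝ → ℂ} {ν : Fin r → ℂ}
    (hf : ∀ j, IsLaguerreEigenfunction α (ν j) (f j))
    {c : ℕ → ℝ → ℂ} {x : ℝ} (hx : 0 < x) (hW : wronskian f x ≠ 0)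
    (hc : ∀ k, AnalyticAt ℝ (c k) x) (hcf : ∀ j t, diffOp r c (f j) t = 0) {β γ : ℂ} {A B : ℕ → ℂ}
    (hA : ∀ k, A k = -x * deriv (deriv (c k)) x + β * deriv (c k) x + γ * c k x - k * c k x)
    (hB : ∀ k, B k = -2 * x * deriv (c k) x + β * c k x - (x - α - 1 - k) * c k x)
    (hr1 : B r = 0) (hr0 : A r + shiftSeq B r = 0) :
    -(x : ℂ) * deriv (deriv (diffOp r c y)) x + β * deriv (diffOp r c y) x + γ * diffOp r c y x
      = μ * diffOp r c y x := by
  -- The same coefficients serve for all seeds, whatever their eigenvalues `ν j`. They form a left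
  -- null vector of the Wronskian matrix at `x`, which is invertible.
  have hR : (fun k : Fin r => A k + shiftSeq B k) = 0 := by
    refine Matrix.eq_zero_of_vecMul_eq_zero hW (funext fun j => ?_)
    have h := (hf j).diffOp_commutator hx hc hA hB hr1 hr0
    have h0 : diffOp r c (f j) = fun _ => 0 := funext (hcf j)
    rw [h0] at h
    simp only [deriv_const', mul_zero, add_zero, sub_zero] at h
    rw [← Fin.sum_univ_eq_sum_range
      (fun k => (A k + shiftSeq B k) * iteratedDeriv k (f j) x)] at h
    simpa [Matrix.vecMul, dotProduct] using h.symm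
  have h := hy.diffOp_commutator hx hc hA hB hr1 hr0
  rw [← Fin.sum_univ_eq_sum_range (fun k => (A k + shiftSeq B k) * iteratedDeriv k y x),
    Finset.sum_eq_zero fun k _ => by
      have := congrFun hR k
      simp only [Pi.zero_apply] at this
      rw [this, zero_mul]] at h
  exact sub_eq_zero.1 h

/-! ### The seed functions and the two solutions to be transformed. -/

namespace MayaPair

variable (M : MayaPair) (α : ℝ)

/-- `true` for the seed functions with a factor `x^{-α}`. -/
def seedType : Fin (M.r₁ + M.r₂ + M.r₃ + M.r₄) → Bool :=
  Fin.append (Fin.append (Fin.append (fun _ => false) (fun _ => false)) (fun _ => true))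
    (fun _ => true)

theorem card_seedType_false :
    (Finset.univ.filter fun j => M.seedType j = false).card = M.r₁ + M.r₂ := by
  rw [Finset.card_filter, Fin.sum_univ_add, Fin.sum_univ_add, Fin.sum_univ_add]
  simp [seedType]

theorem card_seedType_true :
    (Finset.univ.filter fun j => M.seedType j = true).card = M.r₃ + M.r₄ := by
  rw [Finset.card_filter, Fin.sum_univ_add, Fin.sum_univ_add, Fin.sum_univ_add]
  simp [seedType]

/-- The seed functions, as complex valued functions. -/
def seedsC (j : Fin (M.r₁ + M.r₂ + M.r₃ + M.r₄)) (x : ℝ) : ℂ := ((M.seeds α j x : ℝ) : ℂ)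

theorem exists_isKummerSolution_seedsC (j) :
    ∃ (F : ℂ → ℂ) (a : ℂ), IsKummerSolution a (α + 1 + 2 * columnExponent α (M.seedType j)) F ∧
      M.seedsC α j = fun x : ℝ => ((x ^ columnExponent α (M.seedType j) : ℝ) : ℂ) * F x := by
  unfold seedsC
  refine Fin.addCases (fun j => Fin.addCases (fun j => Fin.addCases (fun j => ?_) (fun j => ?_) j)
    (fun j => ?_) j) (fun j => ?_) j
  · obtain ⟨F, hF, hx⟩ := exists_isKummerSolution_laguerrePoly (-α) (M.neg₁ j)
    have hb : ((-α : ℝ) : ℂ) + 1 = α + 1 + 2 * ((-α : ℝ) : ℂ) := by push_cast; ring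
    rw [hb] at hF
    refine ⟨_, _, by simpa [seedType, columnExponent] using hF.exp_mul_comp_neg, ?_⟩
    ext x
    have := hx (-x)
    push_cast at this
    simp [seeds, seedType, columnExponent, this]
    ring
  · obtain ⟨F, hF, hx⟩ := exists_isKummerSolution_laguerrePoly (-α) (M.neg₂ j)
    have hb : ((-α : ℝ) : ℂ) + 1 = α + 1 + 2 * ((-α : ℝ) : ℂ) := by push_cast; ring
    rw [hb] at hF
    refine ⟨F, _, by simpa [seedType, columnExponent] using hF, ?_⟩
    ext x
    simp [seeds, seedType, columnExponent, hx]
  · obtain ⟨F, hF, hx⟩ := exists_isKummerSolution_laguerrePoly α (M.pos₁ j)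
    refine ⟨F, _, by simpa [seedType, columnExponent] using hF, ?_⟩
    ext x
    simp [seeds, seedType, columnExponent, hx]
  · obtain ⟨F, hF, hx⟩ := exists_isKummerSolution_laguerrePoly α (M.pos₂ j)
    refine ⟨_, _, by simpa [seedType, columnExponent] using hF.exp_mul_comp_neg, ?_⟩
    ext x
    have := hx (-x)
    push_cast at this
    simp [seeds, seedType, columnExponent, this]

theorem columnExponent_root (s : Bool) :
    columnExponent α s * (columnExponent α s + α) = 0 := by
  cases s <;> simp [columnExponent]

theorem exists_isLaguerreEigenfunction_seedsC (j) :
    ∃ ν, IsLaguerreEigenfunction α ν (M.seedsC α j) := by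
  obtain ⟨F, a, hF, he⟩ := M.exists_isKummerSolution_seedsC α j
  exact ⟨_, he ▸ hF.rpow_mul (columnExponent_root α _)⟩

theorem analyticAt_seedsC (j) {x : ℝ} (hx : 0 < x) : AnalyticAt ℝ (M.seedsC α j) x := by
  obtain ⟨ν, h⟩ := M.exists_isLaguerreEigenfunction_seedsC α j
  exact h.1 x hx

-- `boldAlpha` differs from `α` by an integer, and 0 is the only integer in (-1,1). Non-integrality
-- of `α` keeps the Kummer parameters `α + 1` and `1 - α` away from the poles.
variable {α} in
theorem ne_intCast (hα₁ : -1 < M.boldAlpha α) (hα₂ : M.boldAlpha α < 1)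
    (hα₀ : M.boldAlpha α ≠ 0) (m : ℤ) : α ≠ m := by
  intro h
  obtain ⟨n, hn⟩ : ∃ n : ℤ, M.boldAlpha α = n :=
    ⟨m + M.r₁ + M.r₂ - M.r₃ - M.r₄, by rw [boldAlpha_eq, h]; push_cast; ring⟩
  rw [hn] at hα₁ hα₂ hα₀
  have h1 : (-1 : ℤ) < n := by exact_mod_cast hα₁
  have h2 : n < 1 := by exact_mod_cast hα₂
  exact hα₀ (by exact_mod_cast (show n = 0 by omega))

end MayaPair

theorem isKummerSolution_hFirst {α : ℝ} (hα : ∀ m : ℤ, α ≠ m) (lam : ℂ) :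
    IsKummerSolution (-lam) (α + 1 + 2 * columnExponent α false) (kummerM (-lam) (α + 1)) := by
  have := isKummerSolution_kummerM (-lam) (α + 1) (fun n h => hα (-n - 1) (by
    have h2 : ((α + 1 : ℝ) : ℂ) = ((-n : ℝ) : ℂ) := by push_cast; exact h
    have h3 := Complex.ofReal_injective h2
    push_cast
    linarith))
  simpa [columnExponent] using this

theorem isKummerSolution_hSecond {α : ℝ} (hα : ∀ m : ℤ, α ≠ m) (lam : ℂ) :
    IsKummerSolution (-lam - α) (α + 1 + 2 * columnExponent α true)
      (kummerM (-lam - α) (1 - α)) := by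
  have := isKummerSolution_kummerM (-lam - α) (1 - α) (fun n h => hα (n + 1) (by
    have h2 : ((1 - α : ℝ) : ℂ) = ((-n : ℝ) : ℂ) := by push_cast; exact h
    have h3 := Complex.ofReal_injective h2
    push_cast
    linarith))
  convert this using 1
  simp only [columnExponent, if_true]
  push_cast
  ring

theorem hFirst_eq (α : ℝ) (lam : ℂ) : hFirst α lam = fun x : ℝ =>
    ((x ^ columnExponent α false : ℝ) : ℂ) * kummerM (-lam) (α + 1) x := by
  ext x; simp [hFirst, columnExponent]

theorem hSecond_eq (α : ℝ) (lam : ℂ) : hSecond α lam = fun x : ℝ =>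
    ((x ^ columnExponent α true : ℝ) : ℂ) * kummerM (-lam - α) (1 - α) x := by
  ext x; simp [hSecond, columnExponent]

theorem isLaguerreEigenfunction_hFirst {α : ℝ} (hα : ∀ m : ℤ, α ≠ m) (lam : ℂ) :
    IsLaguerreEigenfunction α lam (hFirst α lam) := by
  have := (isKummerSolution_hFirst hα lam).rpow_mul (MayaPair.columnExponent_root α false)
  rw [← hFirst_eq] at this
  simpa [columnExponent] using this

theorem isLaguerreEigenfunction_hSecond {α : ℝ} (hα : ∀ m : ℤ, α ≠ m) (lam : ℂ) :
    IsLaguerreEigenfunction α lam (hSecond α lam) := by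
  have := (isKummerSolution_hSecond hα lam).rpow_mul (MayaPair.columnExponent_root α true)
  rw [← hSecond_eq] at this
  convert this using 1
  simp only [columnExponent, if_true]
  push_cast
  ring

/-! ### The Darboux transform intertwines the Laguerre operator with ℒ. -/

namespace MayaPair

variable (M : MayaPair) (α : ℝ)

/-- Analyticity is available for the complexified seeds; their real parts supply the
differentiability of the real iterated derivatives, by induction on the order. -/
theorem ofReal_wronskian_seeds (x : ℝ) (hx : 0 < x) :
    ((wronskian (M.seeds α) x : ℝ) : ℂ) = wronskian (M.seedsC α) x := by
  have key (j) : ∀ k (t : ℝ), 0 < t → iteratedDeriv k (M.seedsC α j) t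
      = ((iteratedDeriv k (M.seeds α j) t : ℝ) : ℂ) := by
    have hre (k : ℕ) (t : ℝ) (ht : 0 < t) :
        AnalyticAt ℝ (fun t => (iteratedDeriv k (M.seedsC α j) t).re) t :=
      (Complex.reCLM.analyticAt _).comp (analyticAt_iteratedDeriv (M.analyticAt_seedsC α j ht) k)
    intro k
    induction k with
    | zero => intro t _; simp [seedsC]
    | succ k ih =>
      intro t ht
      have e : (fun t => (iteratedDeriv k (M.seedsC α j) t).re) =ᶠ[𝓝 t]
          iteratedDeriv k (M.seeds α j) := by
        filter_upwards [lt_mem_nhds ht] with s hs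
        rw [ih s hs, Complex.ofReal_re]
      have hd := ((hre k t ht).congr e).differentiableAt.hasDerivAt
      rw [← iteratedDeriv_succ] at hd
      have e2 : iteratedDeriv k (M.seedsC α j) =ᶠ[𝓝 t]
          fun s => ((iteratedDeriv k (M.seeds α j) s : ℝ) : ℂ) := by
        filter_upwards [lt_mem_nhds ht] with s hs
        exact ih s hs
      rw [iteratedDeriv_succ, e2.deriv_eq, hd.ofReal_comp.deriv]
  unfold wronskian
  rw [← Complex.ofRealHom_eq_coe, RingHom.map_det]
  congr 1
  ext i k
  simp [key _ _ x hx]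

/-- The prefactor of `Ω`. -/
def omegaFactor (x : ℝ) : ℝ :=
  Real.exp (-((M.r₂ : ℝ) + M.r₄) * x) * x ^ ((α + M.r₁ + M.r₂) * ((M.r₃ : ℝ) + M.r₄))

/-- The prefactor of `Ω[h]`. -/
def omegaFirstFactor (x : ℝ) : ℝ :=
  Real.exp (-((M.r₂ : ℝ) + M.r₄) * x) * x ^ ((α + M.r₁ + M.r₂ + 1) * ((M.r₃ : ℝ) + M.r₄))

theorem analyticAt_ofReal_exp_mul (q x : ℝ) :
    AnalyticAt ℝ (fun t : ℝ => ((Real.exp (q * t) : ℝ) : ℂ)) x :=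
  (Complex.ofRealCLM.analyticAt _).comp (f := fun t : ℝ => Real.exp (q * t))
    ((analyticAt_const.mul analyticAt_id).rexp)

theorem analyticAt_exp_mul_rpow (q A : ℝ) {x : ℝ} (hx : 0 < x) :
    AnalyticAt ℝ (fun t : ℝ => ((Real.exp (q * t) * t ^ A : ℝ) : ℂ)) x := by
  simp only [Complex.ofReal_mul]
  exact (analyticAt_ofReal_exp_mul q x).mul (analyticAt_ofReal_rpow A hx)

theorem hasDerivAt_exp_mul_rpow (q A : ℝ) {x : ℝ} (hx : 0 < x) :
    HasDerivAt (fun t : ℝ => ((Real.exp (q * t) * t ^ A : ℝ) : ℂ))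
      (((Real.exp (q * x) * x ^ A : ℝ) : ℂ) * (q + A / x)) x := by
  have h1 : HasDerivAt (fun t : ℝ => ((Real.exp (q * t) : ℝ) : ℂ))
      (((Real.exp (q * x) * (q * 1) : ℝ) : ℂ)) x :=
    (((hasDerivAt_id x).const_mul q).exp).ofReal_comp
  have h2 := h1.mul (hasDerivAt_ofReal_rpow A hx)
  refine (h2.congr_deriv ?_).congr_of_eventuallyEq (Eventually.of_forall fun t => ?_)
  · push_cast; ring
  · simp

theorem deriv_deriv_exp_mul_rpow (q A : ℝ) {x : ℝ} (hx : 0 < x) :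
    deriv (deriv (fun t : ℝ => ((Real.exp (q * t) * t ^ A : ℝ) : ℂ))) x
      = ((Real.exp (q * x) * x ^ A : ℝ) : ℂ) * ((q + A / x) ^ 2 - A / x ^ 2) := by
  have e : deriv (fun t : ℝ => ((Real.exp (q * t) * t ^ A : ℝ) : ℂ)) =ᶠ[𝓝 x]
      fun t => ((Real.exp (q * t) * t ^ A : ℝ) : ℂ) * (q + A / t) := by
    filter_upwards [lt_mem_nhds hx] with t ht
    exact (hasDerivAt_exp_mul_rpow q A ht).deriv
  have hx' : (x : ℂ) ≠ 0 := by exact_mod_cast hx.ne'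
  have h1 : HasDerivAt (fun t : ℝ => (q : ℂ) + A / (t : ℂ)) (-A / x ^ 2) x := by
    have hid : HasDerivAt (fun t : ℝ => (t : ℂ)) 1 x := HasDerivAt.ofReal_comp (hasDerivAt_id x)
    refine (((hid.inv hx').const_mul (A : ℂ)).const_add (q : ℂ)).congr_deriv ?_
    ring
  rw [e.deriv_eq]
  refine ((hasDerivAt_exp_mul_rpow q A hx).mul h1).deriv.trans ?_
  ring

theorem deriv_deriv_mul {f g : ℝ → ℂ} {x : ℝ} (hf : AnalyticAt ℝ f x) (hg : AnalyticAt ℝ g x) :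
    deriv (deriv (fun t => f t * g t)) x
      = deriv (deriv f) x * g x + 2 * deriv f x * deriv g x + f x * deriv (deriv g) x := by
  have e : deriv (fun t => f t * g t) =ᶠ[𝓝 x] fun t => deriv f t * g t + f t * deriv g t := by
    filter_upwards [hf.eventually_analyticAt, hg.eventually_analyticAt] with t h1 h2
    exact deriv_fun_mul h1.differentiableAt h2.differentiableAt
  have h := ((hf.deriv.differentiableAt.hasDerivAt).mul hg.differentiableAt.hasDerivAt).add
    (hf.differentiableAt.hasDerivAt.mul hg.deriv.differentiableAt.hasDerivAt)
  rw [e.deriv_eq]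
  refine h.deriv.trans ?_
  ring

theorem ofReal_omega {x : ℝ} (hx : 0 < x) :
    ((M.omega α x : ℝ) : ℂ) = (M.omegaFactor α x : ℝ) * wronskian (M.seedsC α) x := by
  rw [← M.ofReal_wronskian_seeds α x hx, ← Complex.ofReal_mul]
  rfl

theorem analyticAt_omegaFactor_mul_wronskian {x : ℝ} (hx : 0 < x) :
    AnalyticAt ℝ (fun t => ((M.omegaFactor α t : ℝ) : ℂ) * wronskian (M.seedsC α) t) x :=
  (analyticAt_exp_mul_rpow _ _ hx).mul
    (analyticAt_wronskian fun j => M.analyticAt_seedsC α j hx)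

theorem analyticAt_omega {x : ℝ} (hx : 0 < x) : AnalyticAt ℝ (M.omega α) x := by
  have h := (Complex.reCLM.analyticAt _).comp (M.analyticAt_omegaFactor_mul_wronskian α hx)
  refine h.congr ?_
  filter_upwards [lt_mem_nhds hx] with t ht
  simp only [Function.comp, ← M.ofReal_omega α ht, Complex.reCLM_apply, Complex.ofReal_re]

theorem deriv_ofReal {f : ℝ → ℝ} {x : ℝ} (hf : AnalyticAt ℝ f x) :
    ((deriv f x : ℝ) : ℂ) = deriv (fun t => ((f t : ℝ) : ℂ)) x ∧
    ((deriv (deriv f) x : ℝ) : ℂ) = deriv (deriv (fun t => ((f t : ℝ) : ℂ))) x := by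
  have e : deriv (fun t => ((f t : ℝ) : ℂ)) =ᶠ[𝓝 x] fun t => ((deriv f t : ℝ) : ℂ) := by
    filter_upwards [hf.eventually_analyticAt] with t ht
    exact ht.differentiableAt.hasDerivAt.ofReal_comp.deriv
  refine ⟨e.eq_of_nhds.symm, ?_⟩
  rw [e.deriv_eq, hf.deriv.differentiableAt.hasDerivAt.ofReal_comp.deriv]

/-- The derivatives of `Ω` in terms of those of the Wronskian of the seed functions. -/
theorem deriv_omega {x : ℝ} (hx : 0 < x) {q A : ℂ} (hq : q = -((M.r₂ : ℂ) + M.r₄))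
    (hA : A = (α + M.r₁ + M.r₂) * ((M.r₃ : ℂ) + M.r₄)) :
    ((deriv (M.omega α) x : ℝ) : ℂ) = (M.omegaFactor α x : ℝ) *
      ((q + A / x) * wronskian (M.seedsC α) x + deriv (wronskian (M.seedsC α)) x) ∧
    ((deriv (deriv (M.omega α)) x : ℝ) : ℂ) = (M.omegaFactor α x : ℝ) *
      (((q + A / x) ^ 2 - A / x ^ 2) * wronskian (M.seedsC α) x
        + 2 * (q + A / x) * deriv (wronskian (M.seedsC α)) x
        + deriv (deriv (wronskian (M.seedsC α))) x) := by
  have hW : AnalyticAt ℝ (wronskian (M.seedsC α)) x :=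
    analyticAt_wronskian fun j => M.analyticAt_seedsC α j hx
  have e : (fun t => ((M.omega α t : ℝ) : ℂ)) =ᶠ[𝓝 x]
      fun t => ((M.omegaFactor α t : ℝ) : ℂ) * wronskian (M.seedsC α) t := by
    filter_upwards [lt_mem_nhds hx] with t ht
    exact M.ofReal_omega α ht
  obtain ⟨h1, h2⟩ := deriv_ofReal (M.analyticAt_omega α hx)
  have hP := analyticAt_exp_mul_rpow (-((M.r₂ : ℝ) + M.r₄))
    ((α + M.r₁ + M.r₂) * ((M.r₃ : ℝ) + M.r₄)) hx
  have hP1 := hasDerivAt_exp_mul_rpow (-((M.r₂ : ℝ) + M.r₄))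
    ((α + M.r₁ + M.r₂) * ((M.r₃ : ℝ) + M.r₄)) hx
  have hP2 := deriv_deriv_exp_mul_rpow (-((M.r₂ : ℝ) + M.r₄))
    ((α + M.r₁ + M.r₂) * ((M.r₃ : ℝ) + M.r₄)) hx
  constructor
  · rw [h1, e.deriv_eq]
    refine (hP1.mul hW.differentiableAt.hasDerivAt).deriv.trans ?_
    rw [hq, hA]
    simp only [omegaFactor]
    push_cast
    ring
  · rw [h2, e.deriv.deriv_eq]
    refine (deriv_deriv_mul hP hW).trans ?_
    rw [hP2, hP1.deriv, hq, hA]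
    simp only [omegaFactor]
    push_cast
    ring

/-- The Darboux transform of `y`, normalized as for the solution of the first kind. -/
def transform (y : ℝ → ℂ) (x : ℝ) : ℂ := ((M.omegaFirstFactor α x : ℝ) : ℂ) * M.seedWronskian α y x

theorem transform_eq_diffOp (y : ℝ → ℂ) :
    M.transform α y = diffOp (M.r₁ + M.r₂ + M.r₃ + M.r₄)
      (fun k t => ((M.omegaFirstFactor α t : ℝ) : ℂ) * wronskianMinor (M.seedsC α) k t) y := by
  ext x
  have : M.seedWronskian α y x
      = wronskian (Fin.snoc (α := fun _ => ℝ → ℂ) (M.seedsC α) y) x := rfl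
  rw [transform, this, wronskian_snoc, diffOp, Finset.mul_sum]
  exact Finset.sum_congr rfl fun k _ => (mul_assoc _ _ _).symm

theorem transform_seedsC (j) (x : ℝ) : M.transform α (M.seedsC α j) x = 0 := by
  have := wronskian_snoc_self (M.seedsC α) j x
  have h2 : M.seedWronskian α (M.seedsC α j) x
      = wronskian (Fin.snoc (α := fun _ => ℝ → ℂ) (M.seedsC α) (M.seedsC α j)) x := rfl
  rw [transform, h2, this, mul_zero]

theorem analyticAt_transform {y : ℝ → ℂ} {x : ℝ} (hx : 0 < x) (hy : AnalyticAt ℝ y x) :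
    AnalyticAt ℝ (M.transform α y) x := by
  rw [transform_eq_diffOp]
  exact analyticAt_diffOp (fun k => (analyticAt_exp_mul_rpow _ _ hx).mul
    (analyticAt_wronskianMinor (fun j => M.analyticAt_seedsC α j hx) k)) hy

/-- With E the prefactor, `transform` is an operator of order r with leading coefficients E W and -E
W'. These alone enter the conditions `hr1` and `hr0` of `diffOp_eigen`, which the coefficients of ℒ,
rewritten through W, are checked to satisfy. -/
theorem expression_transform {y : ℝ → ℂ} {lam : ℂ} (hy : IsLaguerreEigenfunction α lam y) {x : ℝ}
    (hx : 0 < x) (hΩ : M.omega α x ≠ 0) :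
    M.expression α (M.transform α y) x = lam * M.transform α y x := by
  choose ν hν using M.exists_isLaguerreEigenfunction_seedsC α
  have hx' : (x : ℂ) ≠ 0 := by exact_mod_cast hx.ne'
  have hΩC : (M.omegaFactor α x : ℂ) * wronskian (M.seedsC α) x ≠ 0 := by
    rw [← M.ofReal_omega α hx]
    exact_mod_cast hΩ
  obtain ⟨hP0, hW0⟩ := mul_ne_zero_iff.1 hΩC
  set q : ℂ := -((M.r₂ : ℂ) + M.r₄) with hq
  set s : ℂ := (M.r₃ : ℂ) + M.r₄ with hs
  set A : ℂ := (α + M.r₁ + M.r₂) * s with hAdef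
  obtain ⟨d1, d2⟩ := M.deriv_omega α hx hq hAdef
  have hE : AnalyticAt ℝ (fun t => ((M.omegaFirstFactor α t : ℝ) : ℂ)) x :=
    analyticAt_exp_mul_rpow (-((M.r₂ : ℝ) + M.r₄))
    ((α + M.r₁ + M.r₂ + 1) * ((M.r₃ : ℝ) + M.r₄)) hx
  have hE1 : deriv (fun t => ((M.omegaFirstFactor α t : ℝ) : ℂ)) x
      = (M.omegaFirstFactor α x : ℝ) * (q + (A + s) / x) := by
    refine (hasDerivAt_exp_mul_rpow (-((M.r₂ : ℝ) + M.r₄))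
      ((α + M.r₁ + M.r₂ + 1) * ((M.r₃ : ℝ) + M.r₄)) hx).deriv.trans ?_
    simp only [omegaFirstFactor, hq, hs, hAdef]
    push_cast
    ring
  have hE2 : deriv (deriv (fun t => ((M.omegaFirstFactor α t : ℝ) : ℂ))) x
      = (M.omegaFirstFactor α x : ℝ) * ((q + (A + s) / x) ^ 2 - (A + s) / x ^ 2) := by
    refine (deriv_deriv_exp_mul_rpow (-((M.r₂ : ℝ) + M.r₄))
      ((α + M.r₁ + M.r₂ + 1) * ((M.r₃ : ℝ) + M.r₄)) hx).trans ?_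
    simp only [omegaFirstFactor, hq, hs, hAdef]
    push_cast
    ring
  have hseeds : ∀ j, AnalyticAt ℝ (M.seedsC α j) x := fun j => M.analyticAt_seedsC α j hx
  have hm := analyticAt_wronskianMinor hseeds
  have hc : ∀ k, AnalyticAt ℝ (fun t => ((M.omegaFirstFactor α t : ℝ) : ℂ)
    * wronskianMinor (M.seedsC α) k t) x := fun k => hE.mul (hm k)
  have hc1 (k) : deriv (fun t => ((M.omegaFirstFactor α t : ℝ) : ℂ)
      * wronskianMinor (M.seedsC α) k t) x = (M.omegaFirstFactor α x : ℝ) *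
        ((q + (A + s) / x) * wronskianMinor (M.seedsC α) k x
          + deriv (wronskianMinor (M.seedsC α) k) x) := by
    refine (deriv_fun_mul (AnalyticAt.differentiableAt hE) (hm k).differentiableAt).trans ?_
    rw [hE1]
    ring
  have hself : wronskianMinor (M.seedsC α) (M.r₁ + M.r₂ + M.r₃ + M.r₄) = wronskian (M.seedsC α) :=
    funext fun t => wronskianMinor_self _ _
  have hbold : (M.boldAlpha α : ℂ) = α + M.r₁ + M.r₂ - s := by
    rw [boldAlpha_eq, hs]; push_cast; ring
  unfold expression
  rw [transform_eq_diffOp]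
  have hβ : ((x - M.boldAlpha α - 1 + 2 * x * (deriv (M.omega α) x / M.omega α x) : ℝ) : ℂ)
      = x - M.boldAlpha α - 1 + 2 * x * (q + A / x
        + deriv (wronskian (M.seedsC α)) x / wronskian (M.seedsC α) x) := by
    push_cast
    rw [d1, M.ofReal_omega α hx]
    field_simp
  have hγ : ((-x * (deriv (deriv (M.omega α)) x / M.omega α x)
        + (M.boldAlpha α - x) * (deriv (M.omega α) x / M.omega α x)
        + M.r₁ - M.r₄ : ℝ) : ℂ) = -x * ((q + A / x) ^ 2 - A / x ^ 2
          + 2 * (q + A / x) * (deriv (wronskian (M.seedsC α)) x / wronskian (M.seedsC α) x)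
          + deriv (deriv (wronskian (M.seedsC α))) x / wronskian (M.seedsC α) x)
        + (M.boldAlpha α - x) * (q + A / x
          + deriv (wronskian (M.seedsC α)) x / wronskian (M.seedsC α) x) + M.r₁ - M.r₄ := by
    push_cast
    rw [d1, d2, M.ofReal_omega α hx]
    field_simp
  rw [hβ, hγ, hbold]
  refine hy.diffOp_eigen hν hx hW0 hc (fun j t => ?_) (fun k => rfl) (fun k => rfl) ?_ ?_
  · rw [← transform_eq_diffOp, transform_seedsC]
  -- Order r + 1. The exponent in the prefactor exceeds that of `omegaFactor` by `s`, contributing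
  -- -2s; this cancels α - α₀ + r = 2s.
  · rw [hc1, hself, hAdef]
    push_cast
    rw [show (M.r₃ : ℂ) = s - M.r₄ by rw [hs]; ring]
    field_simp
    ring
  · rw [hc1, deriv_deriv_mul (f := fun t => ((M.omegaFirstFactor α t : ℝ) : ℂ)) hE (hm _), hE1, hE2,
      hself]
    -- Order r needs the term of index r - 1, whose coefficient is -E W'. The formula also covers r
    -- = 0, where W = 1 and both sides are 0.
    have hsh : ∀ B : ℕ → ℂ, (∀ k, B k = -2 * x * deriv (fun t => ((M.omegaFirstFactor α t : ℝ) : ℂ)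
        * wronskianMinor (M.seedsC α) k t) x
        + (x - (α + M.r₁ + M.r₂ - s) - 1 + 2 * x * (q + A / x
        + deriv (wronskian (M.seedsC α)) x / wronskian (M.seedsC α) x)) *
          ((M.omegaFirstFactor α x : ℝ) * wronskianMinor (M.seedsC α) k x)
        - (x - α - 1 - k) * ((M.omegaFirstFactor α x : ℝ) * wronskianMinor (M.seedsC α) k x)) →
        shiftSeq B (M.r₁ + M.r₂ + M.r₃ + M.r₄) = -(-2 * x * ((M.omegaFirstFactor α x : ℝ) *
        ((q + (A + s) / x) * deriv (wronskian (M.seedsC α)) x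
          + deriv (deriv (wronskian (M.seedsC α))) x))
        + (x - (α + M.r₁ + M.r₂ - s) - 1 + 2 * x * (q + A / x
        + deriv (wronskian (M.seedsC α)) x / wronskian (M.seedsC α) x)) *
          ((M.omegaFirstFactor α x : ℝ) * deriv (wronskian (M.seedsC α)) x)
        - (x - α - (M.r₁ + M.r₂ + s)) *
          ((M.omegaFirstFactor α x : ℝ) * deriv (wronskian (M.seedsC α)) x)) := by
      have hrs : ((M.r₁ : ℂ) + M.r₂ + s) = ((M.r₁ + M.r₂ + M.r₃ + M.r₄ : ℕ) : ℂ) := by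
        rw [hs]; push_cast; ring
      rw [hrs]
      intro B hB
      simp only [hc1] at hB
      clear hβ hγ d1 d2 hc1 hself hc hm hν hbold hΩ hΩC
      generalize M.seedsC α = f at *
      generalize M.r₁ + M.r₂ + M.r₃ + M.r₄ = n at *
      cases n with
      | zero =>
        have : wronskian f = fun _ => 1 := by ext t; simp [wronskian]
        simp [shiftSeq, this]
      | succ n =>
        have hd : deriv (wronskian f) =ᶠ[𝓝 x] fun t => -wronskianMinor f n t := by
          filter_upwards [eventually_all.2 fun j => (hseeds j).eventually_analyticAt] with t ht
          exact (hasDerivAt_wronskian f ht).deriv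
        rw [hd.deriv_eq, shiftSeq, hB, hd.eq_of_nhds, deriv.fun_neg]
        push_cast
        ring
    rw [hsh _ fun k => rfl]
    clear hsh
    push_cast
    rw [show (M.r₃ : ℂ) = s - M.r₄ by rw [hs]; ring]
    rw [hAdef, hq]
    field_simp
    ring

end MayaPair

/-! ### Analytic continuation of Ω, Ω[h], Ω[h̃] to 0. -/

namespace MayaPair

variable (M : MayaPair) {α : ℝ}

theorem exists_analyticAt_omega : ∃ G : ℝ → ℂ, AnalyticAt ℝ G 0 ∧
    ∀ᶠ x : ℝ in 𝓝[>] 0, ((M.omega α x : ℝ) : ℂ) = G x := by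
  choose F a hF he using M.exists_isKummerSolution_seedsC α
  obtain ⟨G, hG, hev⟩ := exists_analyticAt_wronskian (α := α) M.seedType (M.seedsC α)
    (fun j x => F j x) (fun j => analyticAt_comp_ofReal (hF j).1 0)
    (fun j => Eventually.of_forall fun x => congrFun (he j) x)
  rw [card_seedType_false, card_seedType_true] at hev
  refine ⟨fun x => ((Real.exp (-((M.r₂ : ℝ) + M.r₄) * x) : ℝ) : ℂ) * G x,
    (analyticAt_ofReal_exp_mul _ _).mul hG, ?_⟩
  filter_upwards [hev, self_mem_nhdsWithin] with x hx hx0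
  rw [M.ofReal_omega α hx0, ← hx, omegaFactor]
  push_cast
  rw [← add_assoc]
  ring

/-- The appended function raises one of the two column counts by one, according to `s`; this
accounts for the different prefactors of `omegaFirst` and `omegaSecond`. -/
theorem exists_analyticAt_seedWronskian (s : Bool) {h : ℝ → ℂ} {F₀ : ℂ → ℂ} {a₀ b₀ : ℂ}
    (hF₀ : IsKummerSolution a₀ b₀ F₀)
    (hh : h = fun x : ℝ => ((x ^ columnExponent α s : ℝ) : ℂ) * F₀ x) :
    ∃ G : ℝ → ℂ, AnalyticAt ℝ G 0 ∧ ∀ᶠ x : ℝ in 𝓝[>] 0,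
      ((Real.exp (-((M.r₂ : ℝ) + M.r₄) * x) * x ^ ((α + M.r₁ + M.r₂ + (if s then 0 else 1))
        * ((M.r₃ : ℝ) + M.r₄ + (if s then 1 else 0))) : ℝ) : ℂ) * M.seedWronskian α h x = G x := by
  choose F a hF he using M.exists_isKummerSolution_seedsC α
  obtain ⟨G, hG, hev⟩ := exists_analyticAt_wronskian (α := α)
    (Fin.snoc (α := fun _ => Bool) M.seedType s)
    (Fin.snoc (α := fun _ => ℝ → ℂ) (M.seedsC α) h)
    (Fin.snoc (α := fun _ => ℝ → ℂ) (fun j x => F j x) (fun x => F₀ x))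
    (fun j => by
      refine Fin.lastCases ?_ (fun j => ?_) j
      · simpa using analyticAt_comp_ofReal hF₀.1 0
      · simpa using analyticAt_comp_ofReal (hF j).1 0)
    (fun j => Eventually.of_forall fun x => by
      refine Fin.lastCases ?_ (fun j => ?_) j
      · simp [hh]
      · simp [he j])
  have c0 : (Finset.univ.filter fun j =>
      Fin.snoc (α := fun _ => Bool) M.seedType s j = false).card
        = M.r₁ + M.r₂ + if s then 0 else 1 := by
    rw [Finset.card_filter, Fin.sum_univ_castSucc]
    simp only [Fin.snoc_castSucc, Fin.snoc_last]
    rw [← Finset.card_filter, card_seedType_false]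
    cases s <;> simp
  have c1 : (Finset.univ.filter fun j =>
      Fin.snoc (α := fun _ => Bool) M.seedType s j = true).card
        = M.r₃ + M.r₄ + if s then 1 else 0 := by
    rw [Finset.card_filter, Fin.sum_univ_castSucc]
    simp only [Fin.snoc_castSucc, Fin.snoc_last]
    rw [← Finset.card_filter, card_seedType_true]
  rw [c0, c1] at hev
  refine ⟨fun x => ((Real.exp (-((M.r₂ : ℝ) + M.r₄) * x) : ℝ) : ℂ) * G x,
    (analyticAt_ofReal_exp_mul _ _).mul hG, ?_⟩
  filter_upwards [hev] with x hx
  have : M.seedWronskian α h x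
      = wronskian (Fin.snoc (α := fun _ => ℝ → ℂ) (M.seedsC α) h) x := rfl
  rw [← hx, this]
  push_cast
  simp only [← add_assoc]
  ring

theorem exists_analyticAt_omegaFirst (hα : ∀ m : ℤ, α ≠ m) (lam : ℂ) :
    ∃ G : ℝ → ℂ, AnalyticAt ℝ G 0 ∧ ∀ᶠ x : ℝ in 𝓝[>] 0, M.omegaFirst α lam x = G x := by
  simpa [omegaFirst] using M.exists_analyticAt_seedWronskian false
    (isKummerSolution_hFirst hα lam) (hFirst_eq α lam)

theorem exists_analyticAt_omegaSecond (hα : ∀ m : ℤ, α ≠ m) (lam : ℂ) :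
    ∃ G : ℝ → ℂ, AnalyticAt ℝ G 0 ∧ ∀ᶠ x : ℝ in 𝓝[>] 0, M.omegaSecond α lam x = G x := by
  simpa [omegaSecond] using M.exists_analyticAt_seedWronskian true
    (isKummerSolution_hSecond hα lam) (hSecond_eq α lam)

theorem valueAtZero_eq {𝕜 : Type*} [RCLike 𝕜] {F : ℝ → 𝕜} {a : 𝕜}
    (h : Tendsto F (𝓝[>] 0) (𝓝 a)) : valueAtZero F = a := h.limUnder_eq

theorem tendsto_of_eventuallyEq_analyticAt {F G : ℝ → ℂ} (hG : AnalyticAt ℝ G 0)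
    (h : ∀ᶠ x : ℝ in 𝓝[>] 0, F x = G x) : Tendsto F (𝓝[>] 0) (𝓝 (G 0)) :=
  (hG.continuousAt.tendsto.mono_left nhdsWithin_le_nhds).congr' (h.mono fun _ hx => hx.symm)

theorem transform_hFirst (lam : ℂ) : M.transform α (hFirst α lam) = M.omegaFirst α lam := rfl

/-- With a = α+r₁+r₂ and s = r₃+r₄ one has α₀ = a - s, hence (a+1)s = -α₀ + a(s+1). So the factor
x^{-α₀} in `u₂` converts the second normalization into the first, and both solutions belong to the
same ℒ. -/
theorem transform_hSecond (lam : ℂ) {x : ℝ} (hx : 0 < x) :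
    M.transform α (hSecond α lam) x
      = ((x ^ (-M.boldAlpha α) : ℝ) : ℂ) * M.omegaSecond α lam x := by
  have : (α + M.r₁ + M.r₂ + 1) * ((M.r₃ : ℝ) + M.r₄)
      = -M.boldAlpha α + (α + M.r₁ + M.r₂) * ((M.r₃ : ℝ) + M.r₄ + 1) := by
    rw [boldAlpha_eq]; ring
  rw [transform, omegaSecond, omegaFirstFactor, this, Real.rpow_add hx]
  push_cast
  ring

theorem u₁_eq (lam : ℂ) (x : ℝ) : M.u₁ α lam x
    = -((valueAtZero (M.omega α) : ℝ) : ℂ) / (M.boldAlpha α * valueAtZero (M.omegaFirst α lam))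
      * M.omegaFirst α lam x := by
  rw [u₁]; ring

theorem u₂_eq (lam : ℂ) (x : ℝ) : M.u₂ α lam x
    = -((valueAtZero (M.omega α) : ℝ) : ℂ) / valueAtZero (M.omegaSecond α lam)
      * (((x ^ (-M.boldAlpha α) : ℝ) : ℂ) * M.omegaSecond α lam x) := by
  rw [u₂]; ring

/-! ### Solutions of ℒf = λf and Abel's identity. -/

theorem isSolutionOn_of_transform {y u : ℝ → ℂ} {lam C : ℂ} {J : Set ℝ}
    (hy : IsLaguerreEigenfunction α lam y) (hJ : ∀ x ∈ J, 0 < x ∧ M.omega α x ≠ 0)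
    (hu : ∀ x, 0 < x → u x = C * M.transform α y x) : M.IsSolutionOn α lam J u := by
  intro x hxJ
  obtain ⟨hx, hΩ⟩ := hJ x hxJ
  have ha := M.analyticAt_transform α hx (hy.1 x hx)
  have e : u =ᶠ[𝓝 x] fun t => C * M.transform α y t := by
    filter_upwards [lt_mem_nhds hx] with t ht using hu t ht
  have hua : AnalyticAt ℝ u x := (analyticAt_const.mul ha).congr e.symm
  refine ⟨hua.differentiableAt, hua.deriv.differentiableAt, ?_⟩
  have h := M.expression_transform α hy hx hΩ
  have e1 : deriv u =ᶠ[𝓝 x] fun t => C * deriv (M.transform α y) t := by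
    filter_upwards [e.deriv, ha.eventually_analyticAt] with t ht hta
    rw [ht, deriv_const_mul _ hta.differentiableAt]
  unfold expression at h ⊢
  rw [e1.deriv_eq, e1.eq_of_nhds, e.eq_of_nhds, deriv_const_mul _ ha.deriv.differentiableAt]
  linear_combination C * h

/-- Abel's identity. -/
theorem hasDerivAt_bracket {f g : ℝ → ℂ} {lam : ℂ} {x : ℝ} (hx : 0 < x) (hΩ : M.omega α x ≠ 0)
    (hf : M.IsSolutionOn α lam {x} f) (hg : M.IsSolutionOn α lam {x} g) :
    HasDerivAt (M.bracket α f g) 0 x := by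
  obtain ⟨f1, f2, f3⟩ := hf x rfl
  obtain ⟨g1, g2, g3⟩ := hg x rfl
  have hid : HasDerivAt (fun t : ℝ => t) 1 x := hasDerivAt_id x
  have hΩd := (M.analyticAt_omega α hx).differentiableAt.hasDerivAt
  have hw := (hid.mul (((Real.hasDerivAt_rpow_const (p := M.boldAlpha α) (Or.inl hx.ne')).mul
    hid.neg.exp).div (hΩd.pow 2) (pow_ne_zero 2 hΩ))).ofReal_comp
  have h := hw.mul ((f1.hasDerivAt.mul g2.hasDerivAt).sub (f2.hasDerivAt.mul g1.hasDerivAt))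
  refine h.congr_deriv ?_
  have hx' : (x : ℂ) ≠ 0 := by exact_mod_cast hx.ne'
  have hΩ' : (M.omega α x : ℂ) ≠ 0 := by exact_mod_cast hΩ
  unfold expression at f3 g3
  simp only [Pi.mul_apply, Pi.div_apply, Pi.pow_apply, Pi.sub_apply, Pi.neg_apply,
    Real.rpow_sub_one hx.ne']
  push_cast at f3 g3 ⊢
  -- The logarithmic derivative of `x * weight` is (α₀+1)/x - 1 - 2Ω'/Ω, exactly the negative of the
  -- first-order coefficient of ℒ divided by `x`.
  have key : (x : ℂ) * (f x * deriv (deriv g) x - deriv (deriv f) x * g x)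
      = (x - M.boldAlpha α - 1 + 2 * x * (deriv (M.omega α) x / M.omega α x))
        * (f x * deriv g x - deriv f x * g x) := by
    linear_combination (g x) * f3 - (f x) * g3
  field_simp at key ⊢
  linear_combination ((x ^ M.boldAlpha α : ℝ) : ℂ) * Complex.exp (-x) * key

theorem bracket_eq_const {f g : ℝ → ℂ} {lam : ℂ} {J : Set ℝ} (hJo : IsOpen J)
    (hJc : IsPreconnected J) (hJ : ∀ x ∈ J, 0 < x ∧ M.omega α x ≠ 0)
    (hf : M.IsSolutionOn α lam J f) (hg : M.IsSolutionOn α lam J g) {x y : ℝ} (hx : x ∈ J)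
    (hy : y ∈ J) : M.bracket α f g x = M.bracket α f g y := by
  have hd : ∀ t ∈ J, HasDerivAt (M.bracket α f g) 0 t := fun t ht =>
    M.hasDerivAt_bracket (hJ t ht).1 (hJ t ht).2 (fun s hs => hf s (by rwa [hs]))
      (fun s hs => hg s (by rwa [hs]))
  exact hJo.is_const_of_deriv_eq_zero hJc
    (fun t ht => (hd t ht).differentiableAt.differentiableWithinAt) (fun t ht => (hd t ht).deriv)
    hx hy

/-- Two solutions with non-zero bracket form a fundamental system. -/
theorem isFundamentalSystemOn_of_bracket_ne_zero {v w : ℝ → ℂ} {lam : ℂ} {J : Set ℝ}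
    (hJo : IsOpen J) (hJc : IsPreconnected J) (hJ : ∀ x ∈ J, 0 < x ∧ M.omega α x ≠ 0)
    (hv : M.IsSolutionOn α lam J v) (hw : M.IsSolutionOn α lam J w) {x₀ : ℝ} (hx₀ : x₀ ∈ J)
    (h0 : M.bracket α v w x₀ ≠ 0) : M.IsFundamentalSystemOn α lam J v w := by
  refine ⟨hv, hw, fun c d hcd => ?_, fun f hf => ?_⟩
  · have h1 := hcd x₀ hx₀
    have h2 : c * deriv v x₀ + d * deriv w x₀ = 0 := by
      have e : (fun x => c * v x + d * w x) =ᶠ[𝓝 x₀] fun _ => 0 := by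
        filter_upwards [hJo.mem_nhds hx₀] with x hx using hcd x hx
      have := (((hv x₀ hx₀).1.hasDerivAt.const_mul c).add
        ((hw x₀ hx₀).1.hasDerivAt.const_mul d)).deriv
      rw [← this]
      exact e.deriv_eq.trans (by simp)
    have hD : v x₀ * deriv w x₀ - deriv v x₀ * w x₀ ≠ 0 := right_ne_zero_of_mul h0
    constructor
    · refine (mul_eq_zero.1 ?_).resolve_right hD
      linear_combination deriv w x₀ * h1 - w x₀ * h2
    · refine (mul_eq_zero.1 ?_).resolve_right hD
      linear_combination v x₀ * h2 - deriv v x₀ * h1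
  -- Cramer's rule: `[f,w] v + [v,f] w = [v,w] f` holds pointwise, and the three brackets are
  -- constant on `J`.
  · refine ⟨M.bracket α f w x₀ / M.bracket α v w x₀, M.bracket α v f x₀ / M.bracket α v w x₀,
      fun x hx => ?_⟩
    have e1 := M.bracket_eq_const hJo hJc hJ hf hw hx hx₀
    have e2 := M.bracket_eq_const hJo hJc hJ hv hf hx hx₀
    have e3 := M.bracket_eq_const hJo hJc hJ hv hw hx hx₀
    rw [← e1, ← e2, ← e3]
    rw [← e3] at h0
    field_simp
    simp only [bracket]
    ring

/-! ### Limits of brackets and square integrability at 0. -/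

theorem tendsto_bracket_aux {k : ℂ} {G₀ H : ℝ → ℂ} (hG₀ : AnalyticAt ℝ G₀ 0) (h0 : G₀ 0 ≠ 0)
    (hH : AnalyticAt ℝ H 0) {e : ℝ} (he : 0 ≤ e) :
    Tendsto (fun x : ℝ => ((Real.exp (-x) * x ^ e : ℝ) : ℂ) / G₀ x ^ 2 * (k * H x)) (𝓝[>] 0)
      (𝓝 (((0 : ℝ) ^ e : ℝ) / G₀ 0 ^ 2 * (k * H 0))) := by
  have h1 : ContinuousAt (fun x : ℝ => Real.exp (-x) * x ^ e) 0 :=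
    (Real.continuous_exp.comp continuous_neg).continuousAt.mul
      (Real.continuousAt_rpow_const 0 e (Or.inr he))
  have h2 : ContinuousAt
      (fun x : ℝ => ((Real.exp (-x) * x ^ e : ℝ) : ℂ) / G₀ x ^ 2 * (k * H x)) 0 :=
    ((Complex.continuous_ofReal.continuousAt.comp h1).div (hG₀.continuousAt.pow 2)
      (pow_ne_zero 2 h0)).mul (continuousAt_const.mul hH.continuousAt)
  have h3 := h2.tendsto.mono_left (nhdsWithin_le_nhds (s := Set.Ioi 0))
  simpa using h3

/-- The brackets of functions of the form `k x^e G` near `0`. -/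
theorem bracket_eventuallyEq {f g G₀ G H : ℝ → ℂ} {e d : ℝ} {k l : ℂ}
    (hG₀ : ∀ᶠ x : ℝ in 𝓝[>] 0, ((M.omega α x : ℝ) : ℂ) = G₀ x)
    (hG : AnalyticAt ℝ G 0) (hH : AnalyticAt ℝ H 0)
    (hf : ∀ᶠ x : ℝ in 𝓝[>] 0, f x = k * (((x ^ e : ℝ) : ℂ) * G x))
    (hg : ∀ᶠ x : ℝ in 𝓝[>] 0, g x = l * (((x ^ d : ℝ) : ℂ) * H x)) :
    ∀ᶠ x : ℝ in 𝓝[>] 0, M.bracket α f g x =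
      ((Real.exp (-x) * x ^ (M.boldAlpha α + e + d) : ℝ) : ℂ) / G₀ x ^ 2 * (k * l *
        ((d - e) * (G x * H x) + x * (G x * deriv H x - deriv G x * H x))) := by
  have hd {u U : ℝ → ℂ} {c : ℝ} {m : ℂ} (hU : AnalyticAt ℝ U 0)
      (hu : ∀ᶠ x : ℝ in 𝓝[>] 0, u x = m * (((x ^ c : ℝ) : ℂ) * U x)) :
      ∀ᶠ x : ℝ in 𝓝[>] 0, deriv u x
        = m * (((x ^ c : ℝ) : ℂ) * (c / x) * U x + ((x ^ c : ℝ) : ℂ) * deriv U x) := by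
    filter_upwards [eventuallyEq_deriv_nhdsGT hu, self_mem_nhdsWithin,
      hU.eventually_analyticAt.filter_mono nhdsWithin_le_nhds] with x hx hx0 hUx
    rw [hx]
    exact (((hasDerivAt_ofReal_rpow c hx0).mul
      hUx.differentiableAt.hasDerivAt).const_mul m).deriv
  filter_upwards [hG₀, hf, hg, hd hG hf, hd hH hg, self_mem_nhdsWithin] with x h0 h1 h2 h3 h4 hx
  have hx : 0 < x := hx
  have hx' : (x : ℂ) ≠ 0 := by exact_mod_cast hx.ne'
  rw [bracket, h1, h2, h3, h4, weight, Real.rpow_add hx, Real.rpow_add hx, ← h0]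
  push_cast
  field_simp
  ring

/-- Setting `φ` to `L` at 0 makes it continuous on the compact interval [0,c], and x^e is integrable
there. -/
theorem integrableOn_mul_rpow {φ : ℝ → ℝ} {e c L : ℝ} (he : -1 < e) (hc : 0 < c)
    (hφ : ContinuousOn φ (Set.Ioc 0 c)) (hL : Tendsto φ (𝓝[>] 0) (𝓝 L)) :
    IntegrableOn (fun x => φ x * x ^ e) (Set.Ioc 0 c) := by
  have h1 : ContinuousOn (Function.update φ 0 L) (Set.Icc 0 c) := by
    rw [continuousOn_update_iff]
    have hs : Set.Icc 0 c \ {0} = Set.Ioc 0 c := Set.Icc_sdiff_left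
    rw [hs]
    exact ⟨hφ, fun _ => hL.mono_left (nhdsWithin_mono _ Set.Ioc_subset_Ioi_self)⟩
  have h2 : IntegrableOn (fun x : ℝ => x ^ e) (Set.Icc 0 c) := by
    rw [integrableOn_Icc_iff_integrableOn_Ioc]
    exact (intervalIntegrable_iff_integrableOn_Ioc_of_le hc.le).1
      (intervalIntegral.intervalIntegrable_rpow' he)
  have h3 := (h2.continuousOn_mul h1 isCompact_Icc).mono_set
    (Set.Ioc_subset_Icc_self (a := (0 : ℝ)) (b := c))
  refine h3.congr_fun (fun x hx => ?_) measurableSet_Ioc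
  simp [Function.update_of_ne hx.1.ne']

/-- Used with `e = 0` and `e = -α₀`: the condition `he` then reads α₀ > -1, respectively α₀ < 1. -/
theorem integrableOn_norm_sq_mul_weight {u : ℝ → ℂ} {e c : ℝ} (hc : 0 < c)
    (he : -1 < M.boldAlpha α + 2 * e) (hΩ : ∀ x, 0 < x → x ≤ c → M.omega α x ≠ 0)
    (hG₀ : Tendsto (M.omega α) (𝓝[>] 0) (𝓝 (valueAtZero (M.omega α))))
    (h0 : valueAtZero (M.omega α) ≠ 0) {g : ℝ → ℂ} {a : ℂ}
    (hg : ∀ x, 0 < x → ContinuousAt g x) (ha : Tendsto g (𝓝[>] 0) (𝓝 a))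
    (hu : ∀ x, 0 < x → u x = ((x ^ e : ℝ) : ℂ) * g x) :
    IntegrableOn (fun x => ‖u x‖ ^ 2 * M.weight α x) (Set.Ioc 0 c) := by
  have h1 : IntegrableOn (fun x => (‖g x‖ ^ 2 * Real.exp (-x) / M.omega α x ^ 2)
      * x ^ (M.boldAlpha α + 2 * e)) (Set.Ioc 0 c) := by
    refine integrableOn_mul_rpow (L := ‖a‖ ^ 2 * Real.exp (-0) / valueAtZero (M.omega α) ^ 2)
      he hc (fun x hx => ContinuousAt.continuousWithinAt ?_) ?_
    · exact (((hg x hx.1).norm.pow 2).mul (Real.continuous_exp.comp continuous_neg).continuousAt).div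
        ((M.analyticAt_omega α hx.1).continuousAt.pow 2) (pow_ne_zero 2 (hΩ x hx.1 hx.2))
    · exact ((ha.norm.pow 2).mul ((Real.continuous_exp.comp continuous_neg).continuousAt.tendsto.mono_left
        nhdsWithin_le_nhds)).div (hG₀.pow 2) (pow_ne_zero 2 h0)
  refine h1.congr_fun (fun x hx => ?_) measurableSet_Ioc
  have hx0 := hx.1
  simp only [weight, hu x hx0, norm_mul, Complex.norm_real, Real.norm_eq_abs,
    abs_of_pos (Real.rpow_pos_of_pos hx0 e)]
  rw [Real.rpow_add hx0, mul_comm 2 e, Real.rpow_mul hx0.le, Real.rpow_two]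
  ring

/-- It is applied with `c = 0`, where `0 ^ 0 = 1` for real powers and only the term (d-e)GH remains.
-/
theorem tendsto_bracket {f g G₀ G H : ℝ → ℂ} {e d c : ℝ} {k l : ℂ}
    (hG₀a : AnalyticAt ℝ G₀ 0) (h0 : G₀ 0 ≠ 0)
    (hG₀ : ∀ᶠ x : ℝ in 𝓝[>] 0, ((M.omega α x : ℝ) : ℂ) = G₀ x)
    (hG : AnalyticAt ℝ G 0) (hH : AnalyticAt ℝ H 0)
    (hf : ∀ᶠ x : ℝ in 𝓝[>] 0, f x = k * (((x ^ e : ℝ) : ℂ) * G x))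
    (hg : ∀ᶠ x : ℝ in 𝓝[>] 0, g x = l * (((x ^ d : ℝ) : ℂ) * H x))
    (hc : M.boldAlpha α + e + d = c) (hc0 : 0 ≤ c) :
    Tendsto (M.bracket α f g) (𝓝[>] 0)
      (𝓝 (((0 : ℝ) ^ c : ℝ) / G₀ 0 ^ 2 * (k * l * ((d - e) * (G 0 * H 0))))) := by
  have hA : AnalyticAt ℝ (fun x : ℝ => ((d : ℂ) - e) * (G x * H x)
      + x * (G x * deriv H x - deriv G x * H x)) 0 :=
    (analyticAt_const.mul (hG.mul hH)).add ((Complex.ofRealCLM.analyticAt _).mul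
      ((hG.mul hH.deriv).sub (hG.deriv.mul hH)))
  have h1 := tendsto_bracket_aux (k := k * l) hG₀a h0 hA hc0
  simp only [Complex.ofReal_zero, zero_mul, add_zero] at h1
  refine h1.congr' ?_
  filter_upwards [M.bracket_eventuallyEq hG₀ hG hH hf hg] with x hx
  rw [hx, hc]

/-- If `x G H' - x G' H` is the only contribution, a power of `x` is gained. -/
theorem tendsto_bracket_zero {f g G₀ G H : ℝ → ℂ} {e c : ℝ} {k l : ℂ}
    (hG₀a : AnalyticAt ℝ G₀ 0) (h0 : G₀ 0 ≠ 0)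
    (hG₀ : ∀ᶠ x : ℝ in 𝓝[>] 0, ((M.omega α x : ℝ) : ℂ) = G₀ x)
    (hG : AnalyticAt ℝ G 0) (hH : AnalyticAt ℝ H 0)
    (hf : ∀ᶠ x : ℝ in 𝓝[>] 0, f x = k * (((x ^ e : ℝ) : ℂ) * G x))
    (hg : ∀ᶠ x : ℝ in 𝓝[>] 0, g x = l * (((x ^ e : ℝ) : ℂ) * H x))
    (hc : M.boldAlpha α + e + e + 1 = c) (hc0 : 0 < c) :
    Tendsto (M.bracket α f g) (𝓝[>] 0) (𝓝 0) := by
  have hA : AnalyticAt ℝ (fun x : ℝ => G x * deriv H x - deriv G x * H x) 0 :=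
    (hG.mul hH.deriv).sub (hG.deriv.mul hH)
  have h1 := tendsto_bracket_aux (k := k * l) hG₀a h0 hA hc0.le
  rw [Real.zero_rpow hc0.ne'] at h1
  simp only [Complex.ofReal_zero, zero_div, zero_mul] at h1
  refine h1.congr' ?_
  filter_upwards [M.bracket_eventuallyEq hG₀ hG hH hf hg, self_mem_nhdsWithin] with x hx hx0
  rw [hx, ← hc, Real.rpow_add_one (ne_of_gt hx0)]
  push_cast
  ring

end MayaPair

end ExceptionalLaguerre

end

/-! ### Assembly. -/

theorem mainTheorem12 (M : MayaPair) (α : ℝ) (lam : ℂ)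
    (hα₁ : -1 < M.boldAlpha α) (hα₂ : M.boldAlpha α < 1) (hα₀ : M.boldAlpha α ≠ 0) :
    -- the values at `0` used in the normalization exist
    (Tendsto (M.omega α) (𝓝[>] 0) (𝓝 (valueAtZero (M.omega α))) ∧
      Tendsto (M.omegaFirst α lam) (𝓝[>] 0) (𝓝 (valueAtZero (M.omegaFirst α lam))) ∧
      Tendsto (M.omegaSecond α lam) (𝓝[>] 0) (𝓝 (valueAtZero (M.omegaSecond α lam)))) ∧
    -- and if they are non-zero, so that `u₁`, `u₂` are defined:
    (valueAtZero (M.omega α) ≠ 0 → valueAtZero (M.omegaFirst α lam) ≠ 0 →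
      valueAtZero (M.omegaSecond α lam) ≠ 0 →
      -- fundamental system on `(0,b)`, with `0 < b ≤ ∞`, if the polynomial has no zero there,
      -- and square integrability at the endpoint `0`
      (∀ b : EReal, 0 < b → (∀ x : ℝ, 0 < x → (x : EReal) < b → M.omega α x ≠ 0) →
        M.IsFundamentalSystemOn α lam {x : ℝ | 0 < x ∧ (x : EReal) < b}
          (M.u₁ α lam) (M.u₂ α lam) ∧
        ∀ c : ℝ, 0 < c → (c : EReal) < b →
          IntegrableOn (fun x => ‖M.u₁ α lam x‖ ^ 2 * M.weight α x) (Set.Ioc 0 c) ∧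
          IntegrableOn (fun x => ‖M.u₂ α lam x‖ ^ 2 * M.weight α x) (Set.Ioc 0 c)) ∧
      -- initial conditions at `0`
      Tendsto (fun x : ℝ =>
          !![M.quasiDeriv0 α (M.u₁ α lam) x, M.quasiDeriv0 α (M.u₂ α lam) x;
             M.quasiDeriv1 α (M.u₁ α lam) x, M.quasiDeriv1 α (M.u₂ α lam) x])
        (𝓝[>] 0) (𝓝 (1 : Matrix (Fin 2) (Fin 2) ℂ))) := by
  have hα := M.ne_intCast hα₁ hα₂ hα₀
  obtain ⟨G₀, hG₀a, hG₀⟩ := M.exists_analyticAt_omega (α := α)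
  obtain ⟨G₁, hG₁a, hG₁⟩ := M.exists_analyticAt_omegaFirst hα lam
  obtain ⟨G₂, hG₂a, hG₂⟩ := M.exists_analyticAt_omegaSecond hα lam
  have t0 := MayaPair.tendsto_of_eventuallyEq_analyticAt hG₀a hG₀
  have t1 := MayaPair.tendsto_of_eventuallyEq_analyticAt hG₁a hG₁
  have t2 := MayaPair.tendsto_of_eventuallyEq_analyticAt hG₂a hG₂
  have t0' : Tendsto (M.omega α) (𝓝[>] 0) (𝓝 (G₀ 0).re) :=
    (Complex.continuous_re.tendsto _).comp t0
  -- `G₀ 0` is real, being a limit of values of the real function Ω.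
  have v0 : G₀ 0 = ((valueAtZero (M.omega α) : ℝ) : ℂ) := by
    rw [MayaPair.valueAtZero_eq t0']
    exact tendsto_nhds_unique t0 ((Complex.continuous_ofReal.tendsto _).comp t0')
  have v1 := MayaPair.valueAtZero_eq t1
  have v2 := MayaPair.valueAtZero_eq t2
  refine ⟨⟨by rwa [MayaPair.valueAtZero_eq t0'], by rwa [v1], by rwa [v2]⟩, fun h0 h1 h2 => ?_⟩
  rw [← MayaPair.valueAtZero_eq t0'] at t0'
  have h0C : G₀ 0 ≠ 0 := by rw [v0]; exact_mod_cast h0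
  have h0C' : ((valueAtZero (M.omega α) : ℝ) : ℂ) ≠ 0 := v0 ▸ h0C
  have ha0 : (M.boldAlpha α : ℂ) ≠ 0 := by exact_mod_cast hα₀
  set k₁ : ℂ := -((valueAtZero (M.omega α) : ℝ) : ℂ)
    / (M.boldAlpha α * valueAtZero (M.omegaFirst α lam)) with hk₁
  set k₂ : ℂ := -((valueAtZero (M.omega α) : ℝ) : ℂ) / valueAtZero (M.omegaSecond α lam) with hk₂
  have a1 : ∀ᶠ x : ℝ in 𝓝[>] 0, M.u₁ α lam x = k₁ * (((x ^ (0 : ℝ) : ℝ) : ℂ) * G₁ x) :=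
    hG₁.mono fun x hx => by
      rw [M.u₁_eq, hx, Real.rpow_zero, Complex.ofReal_one, one_mul]
  have a2 : ∀ᶠ x : ℝ in 𝓝[>] 0,
      M.u₂ α lam x = k₂ * (((x ^ (-M.boldAlpha α) : ℝ) : ℂ) * G₂ x) :=
    hG₂.mono fun x hx => by rw [M.u₂_eq, hx]
  have b1 : ∀ᶠ x : ℝ in 𝓝[>] 0, M.refFirst α x
      = (-((valueAtZero (M.omega α) : ℝ) : ℂ) / M.boldAlpha α) *
        (((x ^ (0 : ℝ) : ℝ) : ℂ) * (fun _ => 1 : ℝ → ℂ) x) :=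
    Eventually.of_forall fun x => by simp [MayaPair.refFirst]
  have b2 : ∀ᶠ x : ℝ in 𝓝[>] 0, M.refSecond α x
      = ((valueAtZero (M.omega α) : ℝ) : ℂ) *
        (((x ^ (-M.boldAlpha α) : ℝ) : ℂ) * (fun _ => 1 : ℝ → ℂ) x) :=
    Eventually.of_forall fun x => by simp [MayaPair.refSecond]
  have hone : AnalyticAt ℝ (fun _ => 1 : ℝ → ℂ) 0 := analyticAt_const
  -- Exponents 0 and -α₀ cancel the x^{α₀} of the weight; these are the pairs with a finite, nonzero
  -- limit.
  have q12 := M.tendsto_bracket hG₀a h0C hG₀ hG₁a hG₂a a1 a2 (c := 0) (by ring) le_rfl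
  have q11 := M.tendsto_bracket hG₀a h0C hG₀ hG₁a hone a1 b2 (c := 0) (by ring) le_rfl
  have q22 := M.tendsto_bracket hG₀a h0C hG₀ hG₂a hone a2 b1 (c := 0) (by ring) le_rfl
  -- Equal exponents: the off-diagonal entries decay like a positive power, by α₀ < 1 here and α₀ >
  -- -1 in `q10`.
  have q21 := M.tendsto_bracket_zero hG₀a h0C hG₀ hG₂a hone a2 b2
    (c := 1 - M.boldAlpha α) (by ring) (by linarith)
  have q10 := M.tendsto_bracket_zero hG₀a h0C hG₀ hG₁a hone a1 b1
    (c := M.boldAlpha α + 1) (by ring) (by linarith)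
  rw [v0, ← v1, ← v2, Real.rpow_zero] at q12
  rw [v0, ← v1, Real.rpow_zero] at q11
  rw [v0, ← v2, Real.rpow_zero] at q22
  have hy1 := isLaguerreEigenfunction_hFirst hα lam
  have hy2 := isLaguerreEigenfunction_hSecond hα lam
  refine ⟨fun b hb hΩ => ⟨?_, fun c hc hcb => ?_⟩, ?_⟩
  · have hJo : IsOpen {x : ℝ | 0 < x ∧ (x : EReal) < b} :=
      (isOpen_lt continuous_const continuous_id).inter
        (isOpen_lt continuous_coe_real_ereal continuous_const)
    have hJc : IsPreconnected {x : ℝ | 0 < x ∧ (x : EReal) < b} := by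
      refine Set.OrdConnected.isPreconnected ⟨fun x hx y hy z hz => ⟨hx.1.trans_le hz.1, ?_⟩⟩
      exact (EReal.coe_le_coe_iff.2 hz.2).trans_lt hy.2
    have hJ : ∀ x ∈ {x : ℝ | 0 < x ∧ (x : EReal) < b}, 0 < x ∧ M.omega α x ≠ 0 :=
      fun x hx => ⟨hx.1, hΩ x hx.1 hx.2⟩
    have hlim : (((1 : ℝ) : ℂ) / ((valueAtZero (M.omega α) : ℝ) : ℂ) ^ 2 * (k₁ * k₂ *
        ((((-M.boldAlpha α : ℝ) : ℂ) - ((0 : ℝ) : ℂ)) * (valueAtZero (M.omegaFirst α lam) *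
          valueAtZero (M.omegaSecond α lam))))) ≠ 0 := by
      have : (((1 : ℝ) : ℂ) / ((valueAtZero (M.omega α) : ℝ) : ℂ) ^ 2 * (k₁ * k₂ *
        ((((-M.boldAlpha α : ℝ) : ℂ) - ((0 : ℝ) : ℂ)) * (valueAtZero (M.omegaFirst α lam) *
          valueAtZero (M.omegaSecond α lam))))) = -1 := by
        rw [hk₁, hk₂]
        push_cast
        field_simp
        ring
      rw [this]
      norm_num
    have hJ0 : ∀ᶠ x : ℝ in 𝓝[>] 0, x ∈ {x : ℝ | 0 < x ∧ (x : EReal) < b} := by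
      filter_upwards [self_mem_nhdsWithin, nhdsWithin_le_nhds
        ((continuous_coe_real_ereal.tendsto (0 : ℝ)).eventually_lt_const hb)]
        with x hx hxb using ⟨hx, hxb⟩
    -- The limit -1 makes [u₁,u₂] nonzero at some point of the interval close to 0, which suffices
    -- for a basis.
    obtain ⟨x₀, hx₀, hx₀b⟩ := ((q12.eventually_ne hlim).and hJ0).exists
    refine M.isFundamentalSystemOn_of_bracket_ne_zero hJo hJc hJ
      (M.isSolutionOn_of_transform (C := k₁) hy1 hJ fun x _ => ?_)
      (M.isSolutionOn_of_transform (C := k₂) hy2 hJ fun x hx => ?_) hx₀b hx₀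
    · rw [M.u₁_eq, M.transform_hFirst]
    · rw [M.u₂_eq, M.transform_hSecond lam hx]
  · have hΩc : ∀ x, 0 < x → x ≤ c → M.omega α x ≠ 0 := fun x hx hxc =>
      hΩ x hx ((EReal.coe_le_coe_iff.2 hxc).trans_lt hcb)
    constructor
    · refine M.integrableOn_norm_sq_mul_weight (e := 0) hc (by linarith) hΩc t0' h0
        (g := fun x => k₁ * M.omegaFirst α lam x) (fun x hx => continuousAt_const.mul ?_)
        (t1.const_mul k₁) fun x _ => by
          rw [M.u₁_eq, Real.rpow_zero, Complex.ofReal_one, one_mul]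
      rw [← M.transform_hFirst]
      exact (M.analyticAt_transform α hx (hy1.1 x hx)).continuousAt
    · refine M.integrableOn_norm_sq_mul_weight (e := -M.boldAlpha α) hc (by linarith) hΩc t0' h0
        (g := fun x => k₂ * M.omegaSecond α lam x) (fun x hx => continuousAt_const.mul ?_)
        (t2.const_mul k₂) fun x _ => by rw [M.u₂_eq]; ring
      -- Continuity of Ω[h̃] at `x > 0` is obtained by undoing the factor x^{-α₀} in
      -- `transform_hSecond`.
      have h := (analyticAt_ofReal_rpow (M.boldAlpha α) hx).mul
        (M.analyticAt_transform α hx (hy2.1 x hx))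
      refine h.continuousAt.congr ?_
      filter_upwards [lt_mem_nhds hx] with t ht
      rw [Pi.mul_apply, M.transform_hSecond lam ht, ← mul_assoc, ← Complex.ofReal_mul,
        ← Real.rpow_add ht]
      simp
  · refine tendsto_pi_nhds.2 fun i => tendsto_pi_nhds.2 fun j => ?_
    fin_cases i <;> fin_cases j
    · refine q11.trans (le_of_eq (congrArg 𝓝 ?_))
      rw [hk₁]
      simp
      field_simp
    · exact q21.trans (le_of_eq (congrArg 𝓝 (by simp)))
    · exact q10.trans (le_of_eq (congrArg 𝓝 (by simp)))
    · refine q22.trans (le_of_eq (congrArg 𝓝 ?_))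
      rw [hk₂]
      simp
      field_simp
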